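/- **Setting.** Let $n,N\ge 1$ and $p\ge 0$ be integers, $A\in\mathbb R^{n\times n}$, $C\in\mathbb R^{p\times n}$, $\sigma\in\mathbb R$. The plant is $\dot x=Ax$, and agent $i\in\mathcal V=\{1,\dots,N\}$ measures $y_i=Cx+m_i$. Let $\Gamma=(\mathcal V,\mathcal E,G)$ be a digraph with $(i,i)\in\mathcal E$ for all $i$, with adjacency matrix $G$ ($g_{ij}=1$ if $(i,j)\in\mathcal E$, and $0$ otherwise) and in-degree matrix $D=\operatorname{diag}(\sum_j g_{ji})_i$. Let $\mathcal I(i)=\{j:(j,i)\in\mathcal E\}$. Agent $i$ runs $\dot{\hat x}_i=A\hat x_i-\sum_{j\in\mathcal I(i)}K_{ij}(C\hat x_j-y_j)$ and uses the estimate $\bar x_i=\frac1{\operatorname{card}\mathcal I(i)}\sum_{j\in\mathcal I(i)}\hat x_j$. With $e_i=\hat x_i-x$, $\bar e_i=\bar x_i-x$ and $\mathcal K=(K_{ij})$, $K_{ij}\in\mathbb R^{n\times p}$, this gives the error system $\dot e=\mathcal A e+\mathcal B m$, $\bar e=\mathcal C e$, where $$\mathcal A=I_N\otimes A-(\mathcal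 K*G^\top)(I_N\otimes C),\qquad \mathcal B=\mathcal K*G^\top,\qquad \mathcal C=(D^{-1}\otimes I_n)(G^\top\otimes I_n),$$ and $*$ is the Khatri–Rao product (the $(i,j)$ block of $\mathcal K*G^\top$ is $g_{ji}K_{ij}$). Let $\mathcal C_i$ be the submatrix of $\mathcal C$ formed by rows $in-n+1,\dots,in$. Let $\mathcal X=\mathcal C$ (global case) or $\mathcal X=\mathcal C_i$ for some $i$ (local case). The corresponding $H_\infty$ gain is $\|T_{\mathcal K}\|_\infty=\sup_{\omega\in\mathbb R}\|T_{\mathcal K}(j\omega)\|$, where $T_{\mathcal K}(s)=\mathcal X(sI-\mathcal A)^{-1}\mathcal B$ and $\|\cdot\|$ is the induced Euclidean norm. If $\mathcal A$ is Hurwitz, the rate of convergence of the error system is $|\max\{\operatorname{Re}\lambda:\lambda\in\operatorname{eig}(\mathcal A)\}|$. Write $\operatorname{He}(M,P)=M^\top P+P^\top M$. For $\mathcal K$ and real $\gamma$, $\sigma$, let $\mathrm{LMI}_\sigma(\mathcal K,\gamma)$ be the statement that there are real matrices $P_S=P_S^\top>0$ and $P_H=P_H^\top>0$ such that $$\operatorname{He}(\mathcal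 A,P_S)+2\sigma P_S<0,\qquad \begin{bmatrix}\operatorname{He}(\mathcal A,P_H)&P_H\mathcal B&\mathcal X^\top\\ \mathcal B^\top P_H&-\gamma I&0\\ \mathcal X&0&-\gamma I\end{bmatrix}<0 .$$ The optimization problem over a set $F$ of pairs $(\mathcal K,\gamma)$ is: $\inf\gamma$ subject to $(\mathcal K,\gamma)\in F$, with value $+\infty$ if $F=\emptyset$. A gain $\mathcal K$ is said to *solve* it if $(\mathcal K,\gamma)\in F$ for some $\gamma$ and $\inf\{\gamma:(\mathcal K,\gamma)\in F\}$ equals the optimal value. **Theorem.** In the global case, and in the local case for each $i$, the following hold. 1. For all $\mathcal K$ and $\gamma\in\mathbb R$: $\mathrm{LMI}_\sigma(\mathcal K,\gamma)$ holds if and only if $\mathcal A$ is Hurwitz, the rate of convergence is larger than $\sigma$, and $\|T_{\mathcal K}\|_\infty<\gamma$. 2. Consequently, the optimal value of the problem $\inf\gamma$ subject to $\mathrm{LMI}_\sigma(\mathcal K,\gamma)$ is the infimum of $\|T_{\mathcal K}\|_\infty$ over all $\mathcal K$ for which $\mathcal A$ is Hurwitz with rate of convergence larger than $\sigma$. Moreover,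 $\mathcal K$ minimizes the $H_\infty$ gain among these gains if and only if $\mathcal K$ solves this optimization problem. 3. The same holds for rate of convergence *larger than or equal to* $\sigma$ when the strict inequalities are replaced by their limiting form, in which $(\mathcal K,\gamma)$ is admitted if $\mathrm{LMI}_{\sigma'}(\mathcal K,\gamma')$ holds for all $\sigma'<\sigma$ and all $\gamma'>\gamma$. Such a pair is admitted if and only if $\mathcal A$ is Hurwitz, the rate of convergence is at least $\sigma$, and $\|T_{\mathcal K}\|_\infty\le\gamma$. The optimal value is the infimum of $\|T_{\mathcal K}\|_\infty$ over all $\mathcal K$ for which $\mathcal A$ is Hurwitz with rate at least $\sigma$, and $\mathcal K$ minimizes the $H_\infty$ gain among these gains if and only if it solves the optimization problem over the admitted pairs. -/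

import Mathlib

open scoped Matrix Kronecker

noncomputable section

namespace InterconnectedObserver

/-- `He(M, P) = Mᵀ P + Pᵀ M`. -/
def He {s : Type*} [Fintype s] (M P : Matrix s s ℝ) : Matrix s s ℝ :=
  Mᵀ * P + Pᵀ * M

/-- `M < 0` for a real matrix: symmetric and negative definite. -/
def NegDef {s : Type*} (M : Matrix s s ℝ) : Prop :=
  (-M).PosDef

section Graph

variable {N : ℕ}

open Classical in
/-- Adjacency matrix of a digraph: `g i j = 1` if there is an edge from `i` to `j`, else `0`. -/
def adjacency (Γ : Digraph (Fin N)) : Matrix (Fin N) (Fin N) ℝ :=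
  Matrix.of fun i j => if Γ.Adj i j then 1 else 0

/-- In-degree matrix: diagonal with entries `d i = ∑ j, g j i`. -/
def inDegreeMatrix (Γ : Digraph (Fin N)) : Matrix (Fin N) (Fin N) ℝ :=
  Matrix.diagonal fun i => ∑ j, adjacency Γ j i

end Graph

/-- A full gain matrix `K`: an `N × N` block matrix whose blocks `K i j` are `n × p`. The entry in
row `a` and column `b` of the block `K i j` is `K (i, a) (j, b)`. -/
abbrev Gain (n p N : ℕ) : Type :=
  Matrix (Fin N × Fin n) (Fin N × Fin p) ℝ

/-- Khatri-Rao product of a block matrix (`n × p` blocks) with an `N × N` matrix of scalar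
blocks: the `(i, j)` block is the Kronecker product of the block `K i j` and the scalar `H i j`. -/
def khatriRao {n p N : ℕ} (K : Gain n p N) (H : Matrix (Fin N) (Fin N) ℝ) : Gain n p N :=
  Matrix.of fun r c => K r c * H r.1 c.1

section ErrorSystem

variable {n p N : ℕ}

/-- `𝓑 = K * Gᵀ` (Khatri-Rao product). -/
def calB (Γ : Digraph (Fin N)) (K : Gain n p N) : Gain n p N :=
  khatriRao K (adjacency Γ)ᵀ

/-- `𝓐 = I_N ⊗ A - (K * Gᵀ) (I_N ⊗ C)`. -/
def calA (A : Matrix (Fin n) (Fin n) ℝ) (C : Matrix (Fin p) (Fin n) ℝ) (Γ : Digraph (Fin N))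
    (K : Gain n p N) : Matrix (Fin N × Fin n) (Fin N × Fin n) ℝ :=
  (1 : Matrix (Fin N) (Fin N) ℝ) ⊗ₖ A -
    khatriRao K (adjacency Γ)ᵀ * ((1 : Matrix (Fin N) (Fin N) ℝ) ⊗ₖ C)

/-- `𝓒 = (D⁻¹ ⊗ I_n) (Gᵀ ⊗ I_n)`. -/
def calC (n : ℕ) (Γ : Digraph (Fin N)) : Matrix (Fin N × Fin n) (Fin N × Fin n) ℝ :=
  ((inDegreeMatrix Γ)⁻¹ ⊗ₖ (1 : Matrix (Fin n) (Fin n) ℝ)) *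
    ((adjacency Γ)ᵀ ⊗ₖ (1 : Matrix (Fin n) (Fin n) ℝ))

/-- `𝓒_i`: the `n` rows of `𝓒` that belong to agent `i`. -/
def calCLocal (n : ℕ) (Γ : Digraph (Fin N)) (i : Fin N) :
    Matrix (Fin n) (Fin N × Fin n) ℝ :=
  (calC n Γ).submatrix (fun a => (i, a)) id

end ErrorSystem

section LinearSystem

variable {s u z : Type*} [Fintype s] [DecidableEq s]

/-- The eigenvalues (in `ℂ`) of a real square matrix. -/
def eigenvalues (M : Matrix s s ℝ) : Set ℂ :=
  spectrum ℂ (M.map (algebraMap ℝ ℂ))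

/-- All eigenvalues have negative real part. -/
def IsHurwitz (M : Matrix s s ℝ) : Prop :=
  ∀ l ∈ eigenvalues M, l.re < 0

/-- `α(M)`, the largest real part of an eigenvalue. -/
def spectralAbscissa (M : Matrix s s ℝ) : ℝ :=
  sSup (Complex.re '' eigenvalues M)

/-- Rate of convergence of a stable system with state matrix `M`: the absolute value of the real
part of the dominant eigenvalue. Only used together with `IsHurwitz M`. -/
def convergenceRate (M : Matrix s s ℝ) : ℝ :=
  |spectralAbscissa M|

/-- The transfer function `T(ζ) = X (ζ I - M)⁻¹ B`. -/
def transferFunction (M : Matrix s s ℝ) (B : Matrix s u ℝ) (X : Matrix z s ℝ) (ζ : ℂ) :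
    Matrix z u ℂ :=
  X.map (algebraMap ℝ ℂ) * (ζ • (1 : Matrix s s ℂ) - M.map (algebraMap ℝ ℂ))⁻¹ *
    B.map (algebraMap ℝ ℂ)

open scoped Matrix.Norms.L2Operator in
/-- `‖T‖∞ = sup_ω ‖T(jω)‖`, where `‖·‖` is the matrix norm induced by the Euclidean norms. The
value `⊤` means that the supremum is infinite. Only used together with `IsHurwitz M`. -/
def hInfNorm [Fintype u] [DecidableEq u] [Fintype z] [DecidableEq z]
    (M : Matrix s s ℝ) (B : Matrix s u ℝ) (X : Matrix z s ℝ) : EReal :=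
  ⨆ ω : ℝ, ((‖transferFunction M B X (Complex.I * (ω : ℂ))‖ : ℝ) : EReal)

end LinearSystem

section Design

variable {n p N : ℕ} (A : Matrix (Fin n) (Fin n) ℝ) (C : Matrix (Fin p) (Fin n) ℝ)
  (Γ : Digraph (Fin N)) {z : Type*} [Fintype z] [DecidableEq z]

/-- The `H∞` gain from the noise `m` to the output `X e` of the error system obtained with gain
`K`. For `X = 𝓒` it is the global gain (to `ē`), for `X = 𝓒_i` the local gain (to `ē_i`). -/
def hInfGain (X : Matrix z (Fin N × Fin n) ℝ) (K : Gain n p N) : EReal :=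
  hInfNorm (calA A C Γ K) (calB Γ K) X

/-- The error system is stable with rate of convergence larger than `σ`. -/
def RateGT (σ : ℝ) (K : Gain n p N) : Prop :=
  IsHurwitz (calA A C Γ K) ∧ σ < convergenceRate (calA A C Γ K)

/-- The error system is stable with rate of convergence larger than or equal to `σ`. -/
def RateGE (σ : ℝ) (K : Gain n p N) : Prop :=
  IsHurwitz (calA A C Γ K) ∧ σ ≤ convergenceRate (calA A C Γ K)

/-- Among all gains that meet the specification `R`, the gain `K` has minimal `H∞` gain. -/
def MinimizesGain (R : Gain n p N → Prop) (X : Matrix z (Fin N × Fin n) ℝ) (K : Gain n p N) :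
    Prop :=
  R K ∧ ∀ K', R K' → hInfGain A C Γ X K ≤ hInfGain A C Γ X K'

/-- The block matrix
`[He(𝓐, P), P 𝓑, Xᵀ; 𝓑ᵀ P, -γ I, 0; X, 0, -γ I]`. -/
def hInfBlock (X : Matrix z (Fin N × Fin n) ℝ) (K : Gain n p N)
    (P : Matrix (Fin N × Fin n) (Fin N × Fin n) ℝ) (γ : ℝ) :
    Matrix (((Fin N × Fin n) ⊕ (Fin N × Fin p)) ⊕ z) (((Fin N × Fin n) ⊕ (Fin N × Fin p)) ⊕ z) ℝ :=
  Matrix.fromBlocks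
    (Matrix.fromBlocks
      (He (calA A C Γ K) P) (P * calB Γ K)
      ((calB Γ K)ᵀ * P) (-γ • (1 : Matrix (Fin N × Fin p) (Fin N × Fin p) ℝ)))
    (Matrix.fromRows Xᵀ (0 : Matrix (Fin N × Fin p) z ℝ))
    (Matrix.fromCols X (0 : Matrix z (Fin N × Fin p) ℝ))
    (-γ • (1 : Matrix z z ℝ))

/-- The constraints of the optimization problem, in the variables `K`, `P_S`, `P_H`, `γ`. -/
def Constraints (X : Matrix z (Fin N × Fin n) ℝ) (σ : ℝ) (K : Gain n p N)
    (P_S P_H : Matrix (Fin N × Fin n) (Fin N × Fin n) ℝ) (γ : ℝ) : Prop :=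
  NegDef (He (calA A C Γ K) P_S + (2 * σ) • P_S) ∧
  NegDef (hInfBlock A C Γ X K P_H γ) ∧
  P_S.PosDef ∧ P_H.PosDef

/-- `(K, γ)` can be completed by `P_S`, `P_H` to a feasible point of the optimization problem. -/
def Feasible (X : Matrix z (Fin N × Fin n) ℝ) (σ : ℝ) (K : Gain n p N) (γ : ℝ) : Prop :=
  ∃ P_S P_H, Constraints A C Γ X σ K P_S P_H γ

/-- The non-strict (limiting) form of the constraints: `(K, γ)` is feasible after every
relaxation of the rate specification and of the gain level. -/
def LimitFeasible (X : Matrix z (Fin N × Fin n) ℝ) (σ : ℝ) (K : Gain n p N) (γ : ℝ) : Prop :=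
  ∀ σ' < σ, ∀ γ' > γ, Feasible A C Γ X σ' K γ'

/-- Optimal value `inf γ` over all `(K, γ)` in the feasible set `F`; `⊤` if there are none. -/
def optimalValue (F : Gain n p N → ℝ → Prop) : EReal :=
  sInf {v : EReal | ∃ (K : Gain n p N) (γ : ℝ), F K γ ∧ v = γ}

/-- `K` solves the problem `inf γ` over `F`: it is feasible, and the optimal value is already the
infimum of `γ` with this `K`. (The infimum over `γ` need not be attained, as the constraints may
be strict.) -/
def Solves (F : Gain n p N → ℝ → Prop) (K : Gain n p N) : Prop :=
  (∃ γ, F K γ) ∧ sInf {v : EReal | ∃ γ : ℝ, F K γ ∧ v = γ} = optimalValue F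

end Design

end InterconnectedObserver

end

/-! Each matrix inequality is equivalent to a condition on complex vectors. The inequality in `P_S`
is Lyapunov's: it has a positive definite solution exactly when every eigenvalue of 𝓐 has real part
below -σ (`exists_lyapunov_iff`). The block inequality in `P_H` is the bounded real lemma: a
positive definite solution exists exactly when 𝓐 is Hurwitz and the H∞ norm is below γ
(`exists_boundedReal_iff`). The two unknowns are independent, so the conditions are simply conjoined
(`feasible_iff`); the limiting form, optimal values and minimizers are then order theory in `EReal`.

Necessity comes from evaluating the forms at vectors with F v = l E v, where the terms in P reduce
to 2 Re l times a value of P. Sufficiency in both cases is one Kalman-Yakubovich-Popov lemma,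
`exists_negDef_of_frequency_domain`, proved by duality. Hahn-Banach yields a multiplier unless some
H ≥ 0 of trace 1 satisfies F H Eᵀ + E H Fᵀ = 0 and tr(M H) ≥ 0. Write H = V Vᵀ. The first relation
provides a unitary basis (b_i) such that each v = V b_i satisfies E v = 0 or F v = jω E v
(`exists_orthonormalBasis_of_skew`). The frequency inequality makes each nonzero term of tr(M H)
negative, so H = 0, which is absurd.

The resulting P is only symmetric. Its positivity follows from stability: a Cayley transform makes
the form of P decrease along powers that tend to zero (`IsHurwitz.posDef_of_lyapunov`). -/

namespace InterconnectedObserver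

/-! ### Isometries and the factorization behind the dual certificate -/

section UnitaryDiagonalization

open Module

variable {V F : Type*} [NormedAddCommGroup V] [InnerProductSpace ℂ V] [FiniteDimensional ℂ V]
  [NormedAddCommGroup F] [InnerProductSpace ℂ F] [FiniteDimensional ℂ F]

/-- A finite-dimensional operator has a point of the unit circle outside its spectrum. -/
theorem exists_norm_one_not_hasEigenvalue (W : V →ₗ[ℂ] V) :
    ∃ c : ℂ, ‖c‖ = 1 ∧ ¬ End.HasEigenvalue W c := by
  by_contra! h
  have hinf : (Metric.sphere (0 : ℂ) 1).Infinite := by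
    have hinj : Function.Injective (fun t : ℝ => ((1 + t * Complex.I) / (1 - t * Complex.I) : ℂ)) := by
      intro s t hst
      have hs : (1 - s * Complex.I : ℂ) ≠ 0 := fun h0 => by simpa using congrArg Complex.re h0
      have ht : (1 - t * Complex.I : ℂ) ≠ 0 := fun h0 => by simpa using congrArg Complex.re h0
      simp only at hst
      rw [div_eq_div_iff hs ht] at hst
      have := congrArg Complex.im hst
      simp at this
      linarith
    refine (Set.infinite_range_of_injective hinj).mono ?_
    rintro _ ⟨t, rfl⟩
    have hc : (1 - t * Complex.I : ℂ) = (starRingEnd ℂ) (1 + t * Complex.I) := by simp [sub_eq_add_neg]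
    have ht : (1 + t * Complex.I : ℂ) ≠ 0 := fun h0 => by simpa using congrArg Complex.re h0
    simp [hc, div_self, ht, -map_add]
  exact hinf ((End.finite_hasEigenvalue W).subset fun c hc => h c (by simpa using hc))

/-- A linear isometry of a finite-dimensional complex inner product space is diagonalized by an
orthonormal basis (Cayley transform of the spectral theorem for symmetric operators). -/
theorem exists_orthonormalBasis_of_linearIsometry (W : V →ₗᵢ[ℂ] V) :
    ∃ b : OrthonormalBasis (Fin (finrank ℂ V)) ℂ V, ∀ i, ∃ l : ℂ, ‖l‖ = 1 ∧ W (b i) = l • b i := by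
  obtain ⟨c, hc, hce⟩ := exists_norm_one_not_hasEigenvalue W.toLinearMap
  have hinj : Function.Injective (c • LinearMap.id - W.toLinearMap : V →ₗ[ℂ] V) := by
    rw [injective_iff_map_eq_zero]
    intro x hx
    by_contra hx0
    refine hce (End.hasEigenvalue_of_hasEigenvector (x := x) ⟨?_, hx0⟩)
    rw [End.mem_eigenspace_iff]
    simpa [sub_eq_zero, eq_comm (a := W x)] using hx
  let R := LinearEquiv.ofInjectiveEndo _ hinj
  have hR : ∀ x, R x = c • x - W x := fun x => rfl
  let T : V →ₗ[ℂ] V := (Complex.I • (c • LinearMap.id + W.toLinearMap)) ∘ₗ R.symm.toLinearMap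
  have hT : ∀ x, T (R x) = Complex.I • (c • x + W x) := fun x => by simp [T]
  have hcc : (starRingEnd ℂ) c * c = 1 := by
    rw [← Complex.normSq_eq_conj_mul_self, Complex.normSq_eq_norm_sq, hc]; simp
  have hsym : T.IsSymmetric := by
    intro x y
    obtain ⟨x, rfl⟩ := R.surjective x
    obtain ⟨y, rfl⟩ := R.surjective y
    rw [hT, hT, hR, hR]
    simp only [inner_add_left, inner_sub_left, inner_add_right, inner_sub_right, inner_smul_left,
      inner_smul_right, LinearIsometry.inner_map_map, Complex.conj_I]
    linear_combination (-2 * Complex.I * inner ℂ x y) * hcc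
  refine ⟨hsym.eigenvectorBasis rfl, fun i => ?_⟩
  set q := hsym.eigenvectorBasis rfl i
  obtain ⟨μ, hμ⟩ : ∃ μ : ℝ, T q = (μ : ℂ) • q := ⟨_, hsym.apply_eigenvectorBasis rfl i⟩
  have hq : ‖q‖ = 1 := (hsym.eigenvectorBasis rfl).orthonormal.1 i
  -- T is I (c + W)(c - W)⁻¹, a function of W, so it commutes with R = c - W. This turns the
  -- eigenvalue equation of T at q into one for W.
  have hcomm : T (R q) = R (T q) := by
    obtain ⟨p, hp⟩ := R.surjective q
    rw [← hp, hT, hT]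
    simp only [hR, map_sub, map_add, map_smul]
    module
  rw [hT, hμ, map_smul, hR] at hcomm
  have hne : (Complex.I + μ : ℂ) ≠ 0 := fun h0 => by simpa using congrArg Complex.im h0
  have h1 : (Complex.I + μ) • W q = ((μ - Complex.I) * c) • q := by
    linear_combination (norm := module) hcomm
  have h2 : W q = ((Complex.I + μ)⁻¹ * ((μ - Complex.I) * c)) • q := by
    rw [mul_smul, ← h1, smul_smul, inv_mul_cancel₀ hne, one_smul]
  refine ⟨_, ?_, h2⟩
  have := congrArg norm h2
  rwa [norm_smul, W.norm_map, hq, mul_one, eq_comm] at this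

omit [FiniteDimensional ℂ F] in
/-- Two linear maps into the same finite-dimensional space with the same norms differ by an
isometry of the codomain. -/
theorem exists_linearIsometry_of_norm_eq (P R : F →ₗ[ℂ] V) (h : ∀ x, ‖P x‖ = ‖R x‖) :
    ∃ W : V →ₗᵢ[ℂ] V, ∀ x, W (R x) = P x := by
  have hker : LinearMap.ker R ≤ LinearMap.ker P := by
    intro x hx
    rw [LinearMap.mem_ker] at hx ⊢
    rw [← norm_eq_zero, h, hx, norm_zero]
  let L : LinearMap.range R →ₗ[ℂ] V :=
    (LinearMap.ker R).liftQ P hker ∘ₗ R.quotKerEquivRange.symm.toLinearMap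
  have hL : ∀ x, L ⟨R x, LinearMap.mem_range_self R x⟩ = P x := by
    intro x
    have : R.quotKerEquivRange.symm ⟨R x, LinearMap.mem_range_self R x⟩ =
        (LinearMap.ker R).mkQ x := R.quotKerEquivRange_symm_apply_image x _
    simp only [L, LinearMap.comp_apply, LinearEquiv.coe_coe, this]
    simp
  let L' : LinearMap.range R →ₗᵢ[ℂ] V :=
    ⟨L, by rintro ⟨_, x, rfl⟩; rw [hL, h]; rfl⟩
  refine ⟨L'.extend, fun x => ?_⟩
  have := L'.extend_apply ⟨R x, LinearMap.mem_range_self R x⟩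
  exact this.trans (hL x)

/-- If `Y X* + X Y* = 0`, then some orthonormal basis consists of vectors `b` with `X b = 0` or
`Y b = jω X b`. -/
theorem exists_orthonormalBasis_of_skew (X Y : V →ₗ[ℂ] F)
    (h : Y ∘ₗ X.adjoint + X ∘ₗ Y.adjoint = 0) :
    ∃ b : OrthonormalBasis (Fin (finrank ℂ V)) ℂ V,
      ∀ i, X (b i) = 0 ∨ ∃ w : ℝ, Y (b i) = (Complex.I * w) • X (b i) := by
  have h' : ∀ x, Y (X.adjoint x) + X (Y.adjoint x) = 0 := fun x => LinearMap.congr_fun h x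
  have hz : ∀ x, inner ℂ (X.adjoint x) (Y.adjoint x) + inner ℂ (Y.adjoint x) (X.adjoint x) = 0 := by
    intro x
    rw [LinearMap.adjoint_inner_left, LinearMap.adjoint_inner_left, ← inner_add_right, add_comm,
      h', inner_zero_right]
  -- By `hz` the cross terms in the squared norms vanish, so the adjoints of X + Y and X - Y have
  -- equal norms at every point.
  obtain ⟨W, hW⟩ := exists_linearIsometry_of_norm_eq (X + Y).adjoint (X - Y).adjoint (by
    intro x
    rw [← sq_eq_sq₀ (norm_nonneg _) (norm_nonneg _), map_add, map_sub, LinearMap.add_apply,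
      LinearMap.sub_apply, @norm_add_sq ℂ, @norm_sub_sq ℂ]
    have := congrArg Complex.re (hz x)
    rw [Complex.add_re, ← inner_conj_symm (Y.adjoint x), Complex.conj_re] at this
    simp only [RCLike.re_to_complex, Complex.zero_re] at this ⊢
    linarith)
  obtain ⟨b, hb⟩ := exists_orthonormalBasis_of_linearIsometry W
  refine ⟨b, fun i => ?_⟩
  obtain ⟨l, hl, hWb⟩ := hb i
  have hll : (starRingEnd ℂ) l * l = 1 := by
    rw [← Complex.normSq_eq_conj_mul_self, Complex.normSq_eq_norm_sq, hl]; simp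
  -- Taking adjoints in W (X - Y)* = (X + Y)* gives (X + Y) W = X - Y, here applied to an
  -- eigenvector of W.
  have key : l • (X + Y) (b i) = (X - Y) (b i) := by
    refine ext_inner_left ℂ fun v => ?_
    rw [inner_smul_right, ← LinearMap.adjoint_inner_left, ← LinearMap.adjoint_inner_left, ← hW,
      ← W.inner_map_map ((X - Y).adjoint v) (b i), hWb, inner_smul_right]
  simp only [LinearMap.add_apply, LinearMap.sub_apply] at key
  have key2 : (1 + l) • Y (b i) = (1 - l) • X (b i) := by
    linear_combination (norm := module) key
  by_cases hl1 : 1 + l = 0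
  · left
    have h2 : (1 - l) = 2 := by linear_combination -hl1
    rw [hl1, zero_smul, h2] at key2
    exact (smul_eq_zero.mp key2.symm).resolve_left two_ne_zero
  · right
    have hre : ((1 - l) / (1 + l)).re = 0 := by
      have hl0 : l ≠ 0 := fun h0 => by simp [h0] at hl
      have hcj : (starRingEnd ℂ) l = l⁻¹ := eq_inv_of_mul_eq_one_left hll
      -- On the unit circle conj l = l⁻¹, so conjugation changes the sign of this quotient, which is
      -- therefore purely imaginary.
      have h3 : (starRingEnd ℂ) ((1 - l) / (1 + l)) = -((1 - l) / (1 + l)) := by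
        rw [map_div₀, map_sub, map_add, map_one, hcj]
        rw [show 1 - l⁻¹ = -(1 - l) * l⁻¹ by field_simp; ring,
          show 1 + l⁻¹ = (1 + l) * l⁻¹ by field_simp; ring,
          mul_div_mul_right _ _ (inv_ne_zero hl0), neg_div]
      have := congrArg Complex.re h3
      rw [Complex.conj_re, Complex.neg_re] at this
      linarith
    refine ⟨((1 - l) / (1 + l)).im, ?_⟩
    have : Complex.I * (((1 - l) / (1 + l)).im : ℂ) = (1 - l) / (1 + l) := by
      apply Complex.ext <;> simp [hre]
    rw [this, div_eq_inv_mul, mul_smul, ← key2, smul_smul, inv_mul_cancel₀ hl1, one_smul]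

end UnitaryDiagonalization

/-! ### Passage from real to complex matrices -/

/-- A real matrix seen as a complex matrix. -/
noncomputable def cplx {m n : Type*} (M : Matrix m n ℝ) : Matrix m n ℂ :=
  M.map (algebraMap ℝ ℂ)

@[simp]
theorem cplx_apply {m n : Type*} (M : Matrix m n ℝ) (i : m) (j : n) : cplx M i j = (M i j : ℂ) :=
  rfl

section Complexification

variable {l m n : Type*}

theorem cplx_mul [Fintype m] (M : Matrix l m ℝ) (N : Matrix m n ℝ) :
    cplx (M * N) = cplx M * cplx N := Matrix.map_mul

theorem cplx_add (M N : Matrix m n ℝ) : cplx (M + N) = cplx M + cplx N :=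
  Matrix.map_add _ (map_add _) _ _

theorem cplx_neg (M : Matrix m n ℝ) : cplx (-M) = -cplx M :=
  Matrix.map_neg _ (map_neg _) _

theorem cplx_smul (c : ℝ) (M : Matrix m n ℝ) : cplx (c • M) = (c : ℂ) • cplx M := by
  ext; simp

theorem cplx_transpose (M : Matrix m n ℝ) : cplx Mᵀ = (cplx M)ᴴ := by
  ext; simp

theorem cplx_one [DecidableEq n] : cplx (1 : Matrix n n ℝ) = 1 :=
  Matrix.map_one _ (map_zero _) (map_one _)

theorem cplx_zero : cplx (0 : Matrix m n ℝ) = 0 :=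
  Matrix.map_zero _ (map_zero _)

theorem star_dotProduct_cplx_mulVec [Fintype n] (M : Matrix n n ℝ) (x : n → ℝ) :
    star (fun i => (x i : ℂ)) ⬝ᵥ (cplx M *ᵥ fun i => (x i : ℂ)) = ((x ⬝ᵥ (M *ᵥ x) : ℝ) : ℂ) := by
  simp [dotProduct, Matrix.mulVec]

open scoped MatrixOrder in
theorem exists_eq_transpose_mul_self [Fintype n] [DecidableEq n] {M : Matrix n n ℝ}
    (hM : M.PosSemidef) : ∃ B : Matrix n n ℝ, M = Bᵀ * B := by
  obtain ⟨B, hB⟩ := CStarAlgebra.nonneg_iff_eq_star_mul_self.mp hM.nonneg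
  exact ⟨B, by rw [hB, Matrix.star_eq_conjTranspose, Matrix.conjTranspose_eq_transpose_of_trivial]⟩

-- A real Gram factorization M = Bᵀ B stays a Gram factorization over ℂ, and invertibility of M
-- makes B injective there.
open scoped ComplexOrder in
theorem posDef_cplx [Fintype n] [DecidableEq n] {M : Matrix n n ℝ} (hM : M.PosDef) :
    (cplx M).PosDef := by
  obtain ⟨B, hB⟩ := exists_eq_transpose_mul_self hM.posSemidef
  have hu : IsUnit (cplx M) := by
    have := hM.isUnit.map (algebraMap ℝ ℂ).mapMatrix
    exact this
  have hc : cplx M = (cplx B)ᴴ * cplx B := by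
    rw [hB, cplx_mul, ← cplx_transpose]
  have hB' : Function.Injective (cplx B).mulVec := by
    intro x y hxy
    refine Matrix.mulVec_injective_of_isUnit hu ?_
    rw [hc, ← Matrix.mulVec_mulVec, hxy, Matrix.mulVec_mulVec]
  rw [hc]
  exact Matrix.PosDef.conjTranspose_mul_self _ hB'

open scoped ComplexOrder in
/-- Negative definiteness of a real matrix passes to complex vectors. -/
theorem NegDef.re_lt [Fintype n] [DecidableEq n] {M : Matrix n n ℝ} (hM : NegDef M) {v : n → ℂ}
    (hv : v ≠ 0) : (star v ⬝ᵥ (cplx M *ᵥ v)).re < 0 := by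
  have h := (posDef_cplx hM).re_dotProduct_pos hv
  rw [cplx_neg, Matrix.neg_mulVec, dotProduct_neg] at h
  simpa using h

end Complexification

/-! ### Vanishing of the dual certificate -/

section KYP

variable {s m ι : Type*} [Fintype s] [Fintype m] [Fintype ι] [DecidableEq s]
  [DecidableEq ι]

theorem exists_orthonormalBasis_of_skew_matrix (X Y : Matrix s ι ℝ) (h : Y * Xᵀ + X * Yᵀ = 0) :
    ∃ b : OrthonormalBasis (Fin (Module.finrank ℂ (EuclideanSpace ℂ ι))) ℂ (EuclideanSpace ℂ ι),
      ∀ i, cplx X *ᵥ (b i).ofLp = 0 ∨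
        ∃ w : ℝ, cplx Y *ᵥ (b i).ofLp = (Complex.I * w) • cplx X *ᵥ (b i).ofLp := by
  have h' : cplx Y * (cplx X)ᴴ + cplx X * (cplx Y)ᴴ = 0 := by
    rw [← cplx_transpose, ← cplx_transpose, ← cplx_mul, ← cplx_mul, ← cplx_add, h, cplx_zero]
  obtain ⟨b, hb⟩ := exists_orthonormalBasis_of_skew (Matrix.toEuclideanLin (cplx X))
    (Matrix.toEuclideanLin (cplx Y)) (by
      rw [← Matrix.toEuclideanLin_conjTranspose_eq_adjoint,
        ← Matrix.toEuclideanLin_conjTranspose_eq_adjoint]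
      ext1 x
      have := congrArg (fun M => WithLp.toLp 2 (M *ᵥ x.ofLp)) h'
      simpa [Matrix.add_mulVec, Matrix.toLpLin_apply] using this)
  refine ⟨b, fun i => ?_⟩
  refine (hb i).imp (fun h0 => ?_) (Exists.imp fun w hw => ?_)
  · simpa [Matrix.toLpLin_apply] using congrArg WithLp.ofLp h0
  · simpa [Matrix.toLpLin_apply] using congrArg WithLp.ofLp hw

theorem sum_star_dotProduct_orthonormalBasis {κ : Type*} [Fintype κ] (T : Matrix ι ι ℂ)
    (b : OrthonormalBasis κ ℂ (EuclideanSpace ℂ ι)) :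
    ∑ i, star (b i).ofLp ⬝ᵥ (T *ᵥ (b i).ofLp) = T.trace := by
  have h1 := LinearMap.trace_eq_sum_inner (Matrix.toEuclideanLin T) b
  have h2 := LinearMap.trace_eq_sum_inner (Matrix.toEuclideanLin T) (EuclideanSpace.basisFun ι ℂ)
  rw [h2] at h1
  simp only [EuclideanSpace.inner_eq_star_dotProduct, Matrix.toLpLin_apply] at h1
  simp only [Matrix.trace, Matrix.diag]
  refine Eq.trans ?_ (h1.symm.trans ?_)
  · exact Finset.sum_congr rfl fun i _ => dotProduct_comm _ _
  · refine Finset.sum_congr rfl fun i _ => ?_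
    simp

/-- The dual certificate of the KYP lemma vanishes under the frequency domain inequality. -/
theorem eq_zero_of_skew_of_trace_nonneg (E F : Matrix s m ℝ) (M : Matrix m m ℝ)
    (hM : ∀ v : m → ℂ, v ≠ 0 →
      (cplx E *ᵥ v = 0 ∨ ∃ w : ℝ, cplx F *ᵥ v = (Complex.I * w) • cplx E *ᵥ v) →
      (star v ⬝ᵥ (cplx M *ᵥ v)).re < 0)
    (V : Matrix m ι ℝ) (hV : F * V * (E * V)ᵀ + E * V * (F * V)ᵀ = 0)
    (htr : 0 ≤ (Vᵀ * M * V).trace) : V = 0 := by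
  obtain ⟨b, hb⟩ := exists_orthonormalBasis_of_skew_matrix (E * V) (F * V) hV
  have hsum := sum_star_dotProduct_orthonormalBasis (cplx (Vᵀ * M * V)) b
  have hterm : ∀ i, star (b i).ofLp ⬝ᵥ (cplx (Vᵀ * M * V) *ᵥ (b i).ofLp) =
      star (cplx V *ᵥ (b i).ofLp) ⬝ᵥ (cplx M *ᵥ (cplx V *ᵥ (b i).ofLp)) := by
    intro i
    rw [cplx_mul, cplx_mul, cplx_transpose, ← Matrix.mulVec_mulVec, ← Matrix.mulVec_mulVec,
      Matrix.dotProduct_mulVec, ← Matrix.star_mulVec]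
  have htrc : (cplx (Vᵀ * M * V)).trace = (((Vᵀ * M * V).trace : ℝ) : ℂ) := by
    simp [Matrix.trace]
  simp only [hterm] at hsum
  rw [htrc] at hsum
  have hsum' := congrArg Complex.re hsum
  rw [Complex.re_sum, Complex.ofReal_re] at hsum'
  have hneg : ∀ i, cplx V *ᵥ (b i).ofLp ≠ 0 →
      (star (cplx V *ᵥ (b i).ofLp) ⬝ᵥ (cplx M *ᵥ (cplx V *ᵥ (b i).ofLp))).re < 0 := by
    intro i hi
    refine hM _ hi ?_
    simpa [cplx_mul, Matrix.mulVec_mulVec] using hb i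
  have hle : ∀ i, (star (cplx V *ᵥ (b i).ofLp) ⬝ᵥ (cplx M *ᵥ (cplx V *ᵥ (b i).ofLp))).re ≤ 0 := by
    intro i
    by_cases hi : cplx V *ᵥ (b i).ofLp = 0
    · simp [hi]
    · exact (hneg i hi).le
  -- The terms are nonpositive and sum to a nonnegative trace, so none can be strictly negative.
  have hzero : ∀ i, cplx V *ᵥ (b i).ofLp = 0 := by
    intro i
    by_contra hi
    have := Finset.sum_neg' (s := Finset.univ) (fun j _ => hle j) ⟨i, Finset.mem_univ i, hneg i hi⟩
    linarith
  have hlin : Matrix.toEuclideanLin (cplx V) = 0 := by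
    refine b.toBasis.ext fun i => ?_
    simpa [Matrix.toLpLin_apply] using hzero i
  have hV0 : cplx V = 0 := by simpa using hlin
  ext i j
  simpa using congrFun (congrFun hV0 i) j

end KYP

/-! ### Separation and the Kalman-Yakubovich-Popov lemma -/

section KYP

variable {s m : Type*} [Fintype s] [Fintype m] [DecidableEq s] [DecidableEq m]

omit [DecidableEq m] in
theorem convex_posSemidef_trace_one :
    Convex ℝ {H : Matrix m m ℝ | H.PosSemidef ∧ H.trace = 1} := by
  rintro H ⟨hH, hH1⟩ H' ⟨hH', hH1'⟩ a b ha hb hab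
  refine ⟨(hH.smul ha).add (hH'.smul hb), ?_⟩
  rw [Matrix.trace_add, Matrix.trace_smul, Matrix.trace_smul, hH1, hH1']
  simpa using hab

-- The set is the image of the Frobenius unit sphere under V ↦ V Vᵀ, since tr(V Vᵀ) = ‖V‖².
open scoped Matrix.Norms.Frobenius in
theorem isCompact_posSemidef_trace_one :
    IsCompact {H : Matrix m m ℝ | H.PosSemidef ∧ H.trace = 1} := by
  have hnorm : ∀ V : Matrix m m ℝ, (V * Vᵀ).trace = ‖V‖ ^ 2 := by
    intro V
    rw [Matrix.frobenius_norm_def, ← Real.sqrt_eq_rpow, Real.sq_sqrt (by positivity)]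
    simp [Matrix.trace, Matrix.mul_apply, sq]
  have : ProperSpace (Matrix m m ℝ) := FiniteDimensional.proper ℝ _
  have hS := (isCompact_sphere (0 : Matrix m m ℝ) 1).image
    (f := fun V => V * Vᵀ) (by fun_prop)
  convert hS using 1
  ext H
  constructor
  · rintro ⟨hH, hH1⟩
    obtain ⟨B, rfl⟩ := exists_eq_transpose_mul_self hH
    refine ⟨Bᵀ, ?_, by simp⟩
    have := hnorm Bᵀ
    rw [Matrix.transpose_transpose, hH1] at this
    rw [mem_sphere_zero_iff_norm]
    nlinarith [norm_nonneg Bᵀ]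
  · rintro ⟨V, hV, rfl⟩
    rw [mem_sphere_zero_iff_norm] at hV
    refine ⟨?_, by simp [hnorm, hV]⟩
    have := Matrix.posSemidef_self_mul_conjTranspose V
    rwa [Matrix.conjTranspose_eq_transpose_of_trivial] at this

omit [DecidableEq m] in
theorem trace_mul_vecMulVec_self (N : Matrix m m ℝ) (v : m → ℝ) :
    (N * Matrix.vecMulVec v v).trace = v ⬝ᵥ (N *ᵥ v) := by
  rw [Matrix.mul_vecMulVec, Matrix.trace_vecMulVec, dotProduct_comm]

/-- A separating functional for the KYP lemma, in terms of a multiplier `Q`. -/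
theorem exists_multiplier (E F : Matrix s m ℝ) (M : Matrix m m ℝ)
    (hM : ∀ v : m → ℂ, v ≠ 0 →
      (cplx E *ᵥ v = 0 ∨ ∃ w : ℝ, cplx F *ᵥ v = (Complex.I * w) • cplx E *ᵥ v) →
      (star v ⬝ᵥ (cplx M *ᵥ v)).re < 0) :
    ∃ (Q : Matrix s s ℝ) (c : ℝ), 0 < c ∧
      ∀ v : m → ℝ, v ≠ 0 → v ⬝ᵥ ((Eᵀ * Q * F + Fᵀ * Q * E) *ᵥ v) + c * (v ⬝ᵥ (M *ᵥ v)) < 0 := by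
  let ψ : Matrix m m ℝ →ₗ[ℝ] Matrix s s ℝ × ℝ :=
    { toFun := fun H => (F * H * Eᵀ + E * H * Fᵀ, (M * H).trace)
      map_add' := fun H H' => by
        ext <;> simp [Matrix.mul_add, Matrix.add_mul]
        ring
      map_smul' := fun a H => by
        ext <;> simp }
  have : LocallyConvexSpace ℝ (Matrix s s ℝ) :=
    inferInstanceAs (LocallyConvexSpace ℝ (s → s → ℝ))
  have hψ : Continuous ψ := ψ.continuous_of_finiteDimensional
  -- Strict separation of the image of ψ from {0} × [0, ∞); a common point would be a dual
  -- certificate, excluded by the previous lemma.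
  obtain ⟨f, u, v', hu, huv, hv'⟩ := geometric_hahn_banach_compact_closed
    (s := ψ '' {H : Matrix m m ℝ | H.PosSemidef ∧ H.trace = 1})
    (t := ({0} : Set (Matrix s s ℝ)) ×ˢ Set.Ici (0 : ℝ))
    (convex_posSemidef_trace_one.linear_image ψ) (isCompact_posSemidef_trace_one.image hψ)
    ((convex_singleton _).prod (convex_Ici _)) (isClosed_singleton.prod isClosed_Ici) (by
      rw [Set.disjoint_left]
      rintro _ ⟨H, ⟨hH, hH1⟩, rfl⟩ ⟨h1, h2⟩
      obtain ⟨B, rfl⟩ := exists_eq_transpose_mul_self hH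
      have hB : Bᵀ = 0 := by
        refine eq_zero_of_skew_of_trace_nonneg E F M hM Bᵀ ?_ ?_
        · simpa [ψ, Matrix.transpose_mul, Matrix.mul_assoc] using h1
        · have h3 : 0 ≤ (M * (Bᵀ * B)).trace := h2
          rwa [← Matrix.mul_assoc, Matrix.trace_mul_comm, ← Matrix.mul_assoc] at h3
      rw [hB] at hH1
      simp at hH1)
  -- Every functional has the form tr(Q L) + t c; the entries of Q are its values on matrix units.
  have hf : ∀ (L : Matrix s s ℝ) (t : ℝ), f (L, t) =
      ((Matrix.of fun i j => f (Matrix.single j i 1, 0)) * L).trace + t * f (0, 1) := by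
    intro L t
    have h1 : (L, t) = ∑ i, ∑ j, L i j • (Matrix.single i j (1 : ℝ), (0 : ℝ)) + t • (0, 1) := by
      refine Prod.ext ?_ ?_
      · conv_lhs => rw [Matrix.matrix_eq_sum_single L]
        simp [Prod.fst_sum]
      · simp [Prod.snd_sum]
    rw [h1]
    simp only [map_add, map_sum, map_smul, smul_eq_mul]
    congr 1
    simp only [Matrix.trace, Matrix.diag, Matrix.mul_apply, Matrix.of_apply]
    rw [Finset.sum_comm]
    exact Finset.sum_congr rfl fun i _ => Finset.sum_congr rfl fun j _ => mul_comm _ _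
  set Q : Matrix s s ℝ := Matrix.of fun i j => f (Matrix.single j i 1, 0)
  set c := f (0, 1)
  have hu0 : u < 0 := by
    have := hv' (0, 0) ⟨rfl, le_refl (0 : ℝ)⟩
    rw [← Prod.zero_eq_mk, map_zero] at this
    linarith
  -- If c were negative, f would fall below v' far out on the ray {0} × [0, ∞).
  have hc : 0 ≤ c := by
    by_contra! hc
    have h1 := hv' (0, v' / c + 1) ⟨rfl, by
      have : 0 ≤ v' / c ∨ v' / c < 0 := le_or_gt _ _
      have hv0 : v' < 0 := by
        have := hv' (0, 0) ⟨rfl, le_refl (0 : ℝ)⟩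
        rwa [← Prod.zero_eq_mk, map_zero] at this
      have := div_pos_of_neg_of_neg hv0 hc
      exact Set.mem_Ici.mpr (by linarith)⟩
    rw [hf] at h1
    have : v' / c * c = v' := div_mul_cancel₀ _ hc.ne
    simp at h1
    nlinarith
  obtain ⟨C, hC⟩ := isCompact_posSemidef_trace_one.exists_bound_of_continuousOn
    (f := fun H : Matrix m m ℝ => (M * H).trace) (by fun_prop)
  have hC1 : 0 < |C| + 1 := by positivity
  -- The functional may have c = 0. Since |tr(M H)| ≤ C on the compact set, this perturbation costs
  -- less than the gap -u and makes the coefficient positive.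
  refine ⟨Q, c + (-u) / (|C| + 1), add_pos_of_nonneg_of_pos hc (div_pos (by linarith) hC1), ?_⟩
  intro v hv
  have hvv : 0 < v ⬝ᵥ v := by
    have := Matrix.dotProduct_star_self_pos_iff.mpr hv
    simpa using this
  have hD : ((v ⬝ᵥ v)⁻¹ • Matrix.vecMulVec v v) ∈
      {H : Matrix m m ℝ | H.PosSemidef ∧ H.trace = 1} := by
    refine ⟨Matrix.PosSemidef.smul ?_ (by positivity), ?_⟩
    · simpa using Matrix.posSemidef_vecMulVec_self_star v
    · rw [Matrix.trace_smul, Matrix.trace_vecMulVec, smul_eq_mul, inv_mul_cancel₀ hvv.ne']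
  have h1 := hu _ ⟨_, hD, rfl⟩
  have h2 := hC _ hD
  simp only [ψ, LinearMap.coe_mk, AddHom.coe_mk, hf] at h1
  have h3 : (Q * (F * ((v ⬝ᵥ v)⁻¹ • Matrix.vecMulVec v v) * Eᵀ +
      E * ((v ⬝ᵥ v)⁻¹ • Matrix.vecMulVec v v) * Fᵀ)).trace =
      (v ⬝ᵥ v)⁻¹ * (v ⬝ᵥ ((Eᵀ * Q * F + Fᵀ * Q * E) *ᵥ v)) := by
    rw [← trace_mul_vecMulVec_self, Matrix.mul_add, Matrix.trace_add, Matrix.add_mul,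
      Matrix.trace_add, mul_add]
    congr 1
    · rw [← Matrix.mul_assoc, Matrix.trace_mul_comm]
      simp [Matrix.mul_assoc]
    · rw [← Matrix.mul_assoc, Matrix.trace_mul_comm]
      simp [Matrix.mul_assoc]
  have h4 : (M * ((v ⬝ᵥ v)⁻¹ • Matrix.vecMulVec v v)).trace =
      (v ⬝ᵥ v)⁻¹ * (v ⬝ᵥ (M *ᵥ v)) := by
    rw [← trace_mul_vecMulVec_self]; simp
  rw [h3, h4] at h1
  rw [h4, Real.norm_eq_abs] at h2
  set x := v ⬝ᵥ ((Eᵀ * Q * F + Fᵀ * Q * E) *ᵥ v)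
  set y := v ⬝ᵥ (M *ᵥ v)
  set d := v ⬝ᵥ v
  have h5 : d⁻¹ * y < |C| + 1 := by linarith [le_abs_self (d⁻¹ * y), le_abs_self C]
  have h6 : -u / (|C| + 1) * (d⁻¹ * y) < -u := by
    calc -u / (|C| + 1) * (d⁻¹ * y) < -u / (|C| + 1) * (|C| + 1) :=
          mul_lt_mul_of_pos_left h5 (div_pos (by linarith) hC1)
      _ = -u := div_mul_cancel₀ _ hC1.ne'
  have h7 : d⁻¹ * (x + (c + -u / (|C| + 1)) * y) < 0 := by linarith
  exact (pos_iff_neg_of_mul_neg h7).mp (inv_pos.mpr hvv)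

/-- The **Kalman-Yakubovich-Popov lemma** in generalized form: a strict frequency domain
inequality yields a strict linear matrix inequality. -/
theorem exists_negDef_of_frequency_domain (E F : Matrix s m ℝ) (M : Matrix m m ℝ) (hMt : Mᵀ = M)
    (hM : ∀ v : m → ℂ, v ≠ 0 →
      (cplx E *ᵥ v = 0 ∨ ∃ w : ℝ, cplx F *ᵥ v = (Complex.I * w) • cplx E *ᵥ v) →
      (star v ⬝ᵥ (cplx M *ᵥ v)).re < 0) :
    ∃ P : Matrix s s ℝ, Pᵀ = P ∧ NegDef (Fᵀ * P * E + Eᵀ * P * F + M) := by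
  obtain ⟨Q, c, hc, hQ⟩ := exists_multiplier E F M hM
  have hPt : ((2 * c)⁻¹ • (Q + Qᵀ))ᵀ = (2 * c)⁻¹ • (Q + Qᵀ) := by
    simp [Matrix.transpose_add, add_comm]
  -- Symmetrizing Q leaves the quadratic form unchanged, and dividing by c normalizes the
  -- coefficient of M to 1.
  refine ⟨(2 * c)⁻¹ • (Q + Qᵀ), hPt, ?_⟩
  set P := (2 * c)⁻¹ • (Q + Qᵀ) with hP
  have hNt : (Fᵀ * P * E + Eᵀ * P * F + M)ᵀ = Fᵀ * P * E + Eᵀ * P * F + M := by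
    simp only [Matrix.transpose_add, Matrix.transpose_mul, Matrix.transpose_transpose, hPt, hMt,
      Matrix.mul_assoc]
    rw [add_comm (Eᵀ * (P * F))]
  refine Matrix.PosDef.of_dotProduct_mulVec_pos ?_ fun v hv => ?_
  · rw [Matrix.IsHermitian, Matrix.conjTranspose_eq_transpose_of_trivial, Matrix.transpose_neg, hNt]
  · have h1 := hQ v hv
    have h2 : v ⬝ᵥ ((Eᵀ * Q * F + Fᵀ * Q * E)ᵀ *ᵥ v) =
        v ⬝ᵥ ((Eᵀ * Q * F + Fᵀ * Q * E) *ᵥ v) := by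
      rw [Matrix.mulVec_transpose, dotProduct_comm, Matrix.dotProduct_mulVec]
    have h3 : Fᵀ * P * E + Eᵀ * P * F + M = (2 * c)⁻¹ • ((Eᵀ * Q * F + Fᵀ * Q * E) +
        (Eᵀ * Q * F + Fᵀ * Q * E)ᵀ) + M := by
      congr 1
      simp only [hP, Matrix.transpose_add, Matrix.transpose_mul, Matrix.transpose_transpose,
        Matrix.mul_smul, Matrix.smul_mul, Matrix.mul_add, Matrix.add_mul, smul_add,
        Matrix.mul_assoc]
      abel
    rw [star_trivial, Matrix.neg_mulVec, dotProduct_neg, h3, Matrix.add_mulVec, Matrix.smul_mulVec,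
      Matrix.add_mulVec, dotProduct_add, dotProduct_smul, dotProduct_add, h2, smul_eq_mul]
    have h4 : (2 * c)⁻¹ * (v ⬝ᵥ ((Eᵀ * Q * F + Fᵀ * Q * E) *ᵥ v) +
        v ⬝ᵥ ((Eᵀ * Q * F + Fᵀ * Q * E) *ᵥ v)) + v ⬝ᵥ (M *ᵥ v) =
        c⁻¹ * (v ⬝ᵥ ((Eᵀ * Q * F + Fᵀ * Q * E) *ᵥ v) + c * (v ⬝ᵥ (M *ᵥ v))) := by
      field_simp
      ring
    rw [h4]
    have := mul_neg_of_pos_of_neg (inv_pos.mpr hc) h1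
    linarith

end KYP

/-! ### Eigenvalues and the rate of convergence -/

section Eigenvalues

variable {s : Type*} [Fintype s] [DecidableEq s]

theorem mem_eigenvalues_iff {M : Matrix s s ℝ} {l : ℂ} :
    l ∈ eigenvalues M ↔ ∃ v : s → ℂ, v ≠ 0 ∧ cplx M *ᵥ v = l • v := by
  change l ∈ spectrum ℂ (cplx M) ↔ _
  rw [spectrum.mem_iff, Matrix.isUnit_iff_isUnit_det, isUnit_iff_ne_zero, not_not,
    ← Matrix.exists_mulVec_eq_zero_iff]
  simp [Matrix.sub_mulVec, Algebra.algebraMap_eq_smul_one, Matrix.smul_mulVec, sub_eq_zero, eq_comm]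

theorem finite_eigenvalues (M : Matrix s s ℝ) : (eigenvalues M).Finite :=
  Matrix.finite_spectrum (cplx M)

theorem eigenvalues_nonempty [Nonempty s] (M : Matrix s s ℝ) : (eigenvalues M).Nonempty :=
  spectrum.nonempty_of_isAlgClosed_of_finiteDimensional ℂ (cplx M)

/-- Stability makes the abscissa negative, so its absolute value is its negative. Nonemptiness
matters: for an empty spectrum `sSup` returns 0. -/
theorem IsHurwitz.lt_convergenceRate_iff [Nonempty s] {M : Matrix s s ℝ} (hM : IsHurwitz M)
    (r : ℝ) : r < convergenceRate M ↔ ∀ l ∈ eigenvalues M, l.re < -r := by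
  have hfin := (finite_eigenvalues M).image Complex.re
  have hne := (eigenvalues_nonempty M).image Complex.re
  have hlt : ∀ a : ℝ, spectralAbscissa M < a ↔ ∀ l ∈ eigenvalues M, l.re < a := by
    intro a
    rw [spectralAbscissa, hfin.csSup_lt_iff hne, Set.forall_mem_image]
  rw [convergenceRate, abs_of_neg ((hlt 0).mpr hM), ← hlt, lt_neg]

theorem isHurwitz_add_smul_one {M : Matrix s s ℝ} {r : ℝ} (h : ∀ l ∈ eigenvalues M, l.re < -r) :
    IsHurwitz (M + r • 1) := by
  intro l hl
  obtain ⟨v, hv, hMv⟩ := mem_eigenvalues_iff.mp hl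
  have := h (l - r) (mem_eigenvalues_iff.mpr ⟨v, hv, by
    rw [cplx_add, cplx_smul, cplx_one, Matrix.add_mulVec, Matrix.smul_mulVec, Matrix.one_mulVec]
      at hMv
    rw [sub_smul, ← hMv, add_sub_cancel_right]⟩)
  simp at this
  linarith

theorem IsHurwitz.isUnit_sub {M : Matrix s s ℝ} (hM : IsHurwitz M) {l : ℂ} (hl : 0 ≤ l.re) :
    IsUnit (l • 1 - cplx M) := by
  by_contra h
  have : l ∈ eigenvalues M := by
    change l ∈ spectrum ℂ (cplx M)
    rwa [spectrum.mem_iff, Algebra.algebraMap_eq_smul_one]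
  exact absurd (hM l this) (not_lt.mpr hl)

end Eigenvalues

/-! ### Lyapunov's theorem -/

section Lyapunov

variable {s m : Type*} [Fintype s] [DecidableEq s] [Fintype m] [DecidableEq m]

omit [Fintype s] [DecidableEq s] in
theorem transpose_eq_of_posDef {P : Matrix s s ℝ} (hP : P.PosDef) : Pᵀ = P := by
  have := hP.isHermitian
  rwa [Matrix.IsHermitian, Matrix.conjTranspose_eq_transpose_of_trivial] at this

omit [Fintype s] [DecidableEq s] in
theorem isHermitian_cplx {P : Matrix s s ℝ} (hP : Pᵀ = P) : (cplx P).IsHermitian := by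
  rw [Matrix.IsHermitian, ← cplx_transpose, hP]

omit [DecidableEq s] [DecidableEq m] in
/-- Value of the KYP form at a vector with `F v = l E v`. -/
theorem star_dotProduct_kyp (E F : Matrix s m ℝ) (P : Matrix s s ℝ) (hP : Pᵀ = P) {v : m → ℂ}
    {l : ℂ} (hv : cplx F *ᵥ v = l • cplx E *ᵥ v) :
    (star v ⬝ᵥ (cplx (Fᵀ * P * E + Eᵀ * P * F) *ᵥ v)).re =
      2 * l.re * (star (cplx E *ᵥ v) ⬝ᵥ (cplx P *ᵥ (cplx E *ᵥ v))).re := by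
  have him : (star (cplx E *ᵥ v) ⬝ᵥ (cplx P *ᵥ (cplx E *ᵥ v))).im = 0 :=
    (isHermitian_cplx hP).im_star_dotProduct_mulVec_self _
  have h : star v ⬝ᵥ (cplx (Fᵀ * P * E + Eᵀ * P * F) *ᵥ v) =
      star (cplx F *ᵥ v) ⬝ᵥ (cplx P *ᵥ (cplx E *ᵥ v)) +
        star (cplx E *ᵥ v) ⬝ᵥ (cplx P *ᵥ (cplx F *ᵥ v)) := by
    simp only [cplx_add, cplx_mul, cplx_transpose, Matrix.add_mulVec, dotProduct_add,
      Matrix.star_mulVec, Matrix.dotProduct_mulVec, Matrix.vecMul_vecMul, Matrix.mul_assoc]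
  rw [h, hv]
  simp only [star_smul, smul_dotProduct, Matrix.mulVec_smul, dotProduct_smul, smul_eq_mul,
    Complex.add_re, Complex.mul_re, him]
  simp
  ring

/-- A positive definite solution of a strict Lyapunov inequality bounds the eigenvalues. -/
theorem re_lt_of_lyapunov {M P : Matrix s s ℝ} {r : ℝ} (hP : P.PosDef)
    (h : NegDef (He M P + (2 * r) • P)) : ∀ l ∈ eigenvalues M, l.re < -r := by
  intro l hl
  obtain ⟨v, hv, hMv⟩ := mem_eigenvalues_iff.mp hl
  have hPt := transpose_eq_of_posDef hP
  have h1 := h.re_lt hv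
  have h2 := star_dotProduct_kyp 1 M P hPt (v := v) (l := l) (by simpa [cplx_one] using hMv)
  have h3 : 0 < (star v ⬝ᵥ (cplx P *ᵥ v)).re := (posDef_cplx hP).re_dotProduct_pos hv
  simp only [cplx_one, Matrix.one_mulVec, Matrix.mul_one, Matrix.transpose_one, Matrix.one_mul]
    at h2
  rw [cplx_add, Matrix.add_mulVec, dotProduct_add, Complex.add_re, He, hPt, h2, cplx_smul,
    Matrix.smul_mulVec, dotProduct_smul, smul_eq_mul, Complex.re_ofReal_mul] at h1
  nlinarith

open scoped Matrix.Norms.L2Operator in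
/-- Powers of a complex matrix whose eigenvalues lie in the open unit disc tend to zero. -/
theorem tendsto_pow_of_forall_norm_lt_one (T : Matrix s s ℂ)
    (h : ∀ l ∈ spectrum ℂ T, ‖l‖ < 1) :
    Filter.Tendsto (fun k : ℕ => T ^ k) Filter.atTop (nhds 0) := by
  rcases isEmpty_or_nonempty s with hs | hs
  · have : ∀ k : ℕ, T ^ k = 0 := fun k => Subsingleton.elim _ _
    simp [this]
  have : CompleteSpace (Matrix s s ℂ) := FiniteDimensional.complete ℂ _
  have hr : spectralRadius ℂ T < (1 : NNReal) :=
    spectrum.spectralRadius_lt_of_forall_lt T (r := 1) fun l hl => by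
      have := h l hl
      exact_mod_cast this
  -- By Gelfand's formula, ‖T^k‖ is eventually at most q^k for any q between the spectral radius and
  -- 1.
  obtain ⟨q, hq, hq1⟩ := exists_between hr
  have hev := (spectrum.pow_nnnorm_pow_one_div_tendsto_nhds_spectralRadius T).eventually_lt_const hq
  have hq1' : q < 1 := by simpa using hq1
  rw [tendsto_zero_iff_norm_tendsto_zero]
  have hqt : q ≠ ⊤ := ne_top_of_lt hq1
  have hpow : Filter.Tendsto (fun k : ℕ => (q.toReal) ^ k) Filter.atTop (nhds 0) :=
    tendsto_pow_atTop_nhds_zero_of_lt_one ENNReal.toReal_nonneg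
      (by simpa using (ENNReal.toReal_lt_toReal hqt ENNReal.one_ne_top).mpr hq1')
  refine squeeze_zero' (Filter.Eventually.of_forall fun _ => norm_nonneg _) ?_ hpow
  filter_upwards [hev, Filter.eventually_gt_atTop 0] with k hk hk0
  have hk' : (‖T ^ k‖₊ : ENNReal) ≤ q ^ k := by
    have h1 := pow_le_pow_left' hk.le k
    rwa [← ENNReal.rpow_natCast, ← ENNReal.rpow_mul, one_div,
      inv_mul_cancel₀ (by exact_mod_cast hk0.ne'), ENNReal.rpow_one] at h1
  have := ENNReal.toReal_mono (ENNReal.pow_ne_top hqt) hk'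
  simpa using this

/-- For a Hurwitz matrix, solutions of the strict Lyapunov inequality are positive definite. -/
theorem IsHurwitz.posDef_of_lyapunov {M P : Matrix s s ℝ} (hM : IsHurwitz M) (hP : Pᵀ = P)
    (h : NegDef (He M P)) : P.PosDef := by
  have hu : IsUnit (1 - cplx M) := by simpa using hM.isUnit_sub (l := 1) (by simp)
  set S := (1 - cplx M)⁻¹ with hS
  have hSl : S * (1 - cplx M) = 1 := Matrix.nonsing_inv_mul _ ((Matrix.isUnit_iff_isUnit_det _).mp hu)
  have hSr : (1 - cplx M) * S = 1 := Matrix.mul_nonsing_inv _ ((Matrix.isUnit_iff_isUnit_det _).mp hu)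
  -- The Cayley transform maps the open left half-plane to the open unit disc, so powers of T can
  -- replace the matrix exponential.
  set T := (1 + cplx M) * S with hT
  have hT0 : Filter.Tendsto (fun k : ℕ => T ^ k) Filter.atTop (nhds 0) := by
    refine tendsto_pow_of_forall_norm_lt_one T fun l hl => ?_
    rw [spectrum.mem_iff, Matrix.isUnit_iff_isUnit_det, isUnit_iff_ne_zero, not_not,
      ← Matrix.exists_mulVec_eq_zero_iff] at hl
    obtain ⟨v, hv, hTv⟩ := hl
    have hw : S *ᵥ v ≠ 0 := by
      intro h0
      apply hv
      rw [← Matrix.one_mulVec v, ← hSr, ← Matrix.mulVec_mulVec, h0, Matrix.mulVec_zero]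
    set w := S *ᵥ v
    have hvw : v = w - cplx M *ᵥ w := by
      rw [← Matrix.one_mulVec v, ← hSr, ← Matrix.mulVec_mulVec, Matrix.sub_mulVec,
        Matrix.one_mulVec]
    have h1 : w + cplx M *ᵥ w = l • (w - cplx M *ᵥ w) := by
      rw [← hvw]
      rw [Matrix.sub_mulVec, Algebra.algebraMap_eq_smul_one, Matrix.smul_mulVec, Matrix.one_mulVec, hT,
        ← Matrix.mulVec_mulVec, Matrix.add_mulVec, Matrix.one_mulVec, sub_eq_zero] at hTv
      exact hTv.symm
    have h2 : (1 + l) • cplx M *ᵥ w = (l - 1) • w := by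
      linear_combination (norm := module) h1
    by_cases hl1 : 1 + l = 0
    · rw [hl1, zero_smul] at h2
      have : l - 1 ≠ 0 := fun h0 => by
        have : (2 : ℂ) = 0 := by linear_combination hl1 - h0
        norm_num at this
      exact absurd (smul_eq_zero.mp h2.symm) (by simp [this, hw])
    · have h3 : cplx M *ᵥ w = ((l - 1) / (1 + l)) • w := by
        rw [div_eq_inv_mul, mul_smul, ← h2, smul_smul, inv_mul_cancel₀ hl1, one_smul]
      have h4 := hM _ (mem_eigenvalues_iff.mpr ⟨w, hw, h3⟩)
      have h5 : 0 < Complex.normSq (1 + l) := Complex.normSq_pos.mpr hl1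
      have h6 : ((l - 1) / (1 + l)).re * Complex.normSq (1 + l) = Complex.normSq l - 1 := by
        rw [Complex.div_re]
        field_simp
        simp [Complex.normSq_apply]
        ring
      have h7 : Complex.normSq l < 1 := by nlinarith
      rw [Complex.normSq_eq_norm_sq] at h7
      nlinarith [norm_nonneg l]
  let g : (s → ℂ) → ℝ := fun v => (star v ⬝ᵥ (cplx P *ᵥ v)).re
  -- With w = S v, the difference g (T v) - g v equals twice the form of He(M, P) at w.
  have hdec : ∀ v : s → ℂ, v ≠ 0 → g (T *ᵥ v) < g v := by
    intro v hv
    have hw : S *ᵥ v ≠ 0 := by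
      intro h0
      apply hv
      rw [← Matrix.one_mulVec v, ← hSr, ← Matrix.mulVec_mulVec, h0, Matrix.mulVec_zero]
    have h1 := h.re_lt hw
    set w := S *ᵥ v
    have hvw : v = w - cplx M *ᵥ w := by
      rw [← Matrix.one_mulVec v, ← hSr, ← Matrix.mulVec_mulVec, Matrix.sub_mulVec,
        Matrix.one_mulVec]
    have hTw : T *ᵥ v = w + cplx M *ᵥ w := by
      rw [hT, ← Matrix.mulVec_mulVec, Matrix.add_mulVec, Matrix.one_mulVec]
    have h2 : star w ⬝ᵥ (cplx (He M P) *ᵥ w) =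
        star (cplx M *ᵥ w) ⬝ᵥ (cplx P *ᵥ w) + star w ⬝ᵥ (cplx P *ᵥ (cplx M *ᵥ w)) := by
      simp only [He, hP, cplx_add, cplx_mul, cplx_transpose, Matrix.add_mulVec, dotProduct_add,
        Matrix.star_mulVec, Matrix.dotProduct_mulVec, Matrix.vecMul_vecMul]
    rw [h2, Complex.add_re] at h1
    simp only [g]
    rw [hTw, hvw]
    simp only [star_add, star_sub, Matrix.mulVec_add, Matrix.mulVec_sub, add_dotProduct,
      sub_dotProduct, dotProduct_add, dotProduct_sub, Complex.add_re, Complex.sub_re]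
    linarith
  have hle : ∀ v : s → ℂ, g (T *ᵥ v) ≤ g v := by
    intro v
    by_cases hv : v = 0
    · simp [hv]
    · exact (hdec v hv).le
  have hnonneg : ∀ v : s → ℂ, 0 ≤ g v := by
    intro v
    have hanti : ∀ k : ℕ, g ((T ^ k) *ᵥ v) ≤ g v := by
      intro k
      induction k with
      | zero => simp
      | succ k ih =>
        rw [pow_succ', ← Matrix.mulVec_mulVec]
        exact (hle _).trans ih
    have hlim : Filter.Tendsto (fun k : ℕ => g ((T ^ k) *ᵥ v)) Filter.atTop (nhds (g (0 *ᵥ v))) := by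
      have hc : Continuous fun R : Matrix s s ℂ => g (R *ᵥ v) := by
        simp only [g]
        fun_prop
      exact (hc.tendsto 0).comp hT0
    have : g ((0 : Matrix s s ℂ) *ᵥ v) = 0 := by simp [g]
    rw [this] at hlim
    exact le_of_tendsto hlim (Filter.Eventually.of_forall hanti)
  refine Matrix.PosDef.of_dotProduct_mulVec_pos ?_ fun x hx => ?_
  · rw [Matrix.IsHermitian, Matrix.conjTranspose_eq_transpose_of_trivial, hP]
  · have hx' : (fun i => (x i : ℂ)) ≠ 0 := fun h0 => hx (by
      ext i
      simpa using congrFun h0 i)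
    have := (hnonneg _).trans_lt (hdec _ hx')
    simp only [g] at this
    rwa [star_dotProduct_cplx_mulVec, Complex.ofReal_re] at this

/-- **Lyapunov's theorem** for a prescribed decay rate. -/
theorem exists_lyapunov_iff (M : Matrix s s ℝ) (r : ℝ) :
    (∃ P : Matrix s s ℝ, P.PosDef ∧ NegDef (He M P + (2 * r) • P)) ↔
      ∀ l ∈ eigenvalues M, l.re < -r := by
  refine ⟨fun ⟨P, hP, h⟩ => re_lt_of_lyapunov hP h, fun h => ?_⟩
  have hH := isHurwitz_add_smul_one h
  -- The frequency condition is vacuous here: the shifted matrix has no imaginary eigenvalue, so no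
  -- nonzero vector has to be tested.
  obtain ⟨P, hPt, hP⟩ := exists_negDef_of_frequency_domain (1 : Matrix s s ℝ) (M + r • 1) 0
    Matrix.transpose_zero (by
      rintro v hv (h0 | ⟨w, hw⟩)
      · simp [cplx_one, hv] at h0
      · rw [cplx_one, Matrix.one_mulVec] at hw
        have := hH _ (mem_eigenvalues_iff.mpr ⟨v, hv, hw⟩)
        simp at this)
  have hHe : (M + r • 1)ᵀ * P * 1 + 1ᵀ * P * (M + r • 1) + 0 = He (M + r • 1) P := by
    simp [He, hPt]
  rw [hHe] at hP
  refine ⟨P, hH.posDef_of_lyapunov hPt hP, ?_⟩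
  have : He M P + (2 * r) • P = He (M + r • 1) P := by
    simp only [He, hPt, Matrix.transpose_add, Matrix.transpose_smul, Matrix.transpose_one,
      Matrix.add_mul, Matrix.mul_add, Matrix.smul_mul, Matrix.mul_smul, Matrix.one_mul,
      Matrix.mul_one]
    module
  rwa [this]

end Lyapunov

/-! ### The bounded real lemma -/

section BoundedReal

variable {s u z : Type*} [Fintype s] [DecidableEq s] [Fintype u] [DecidableEq u] [Fintype z]
  [DecidableEq z]

/-- The part of the bounded real matrix inequality that does not involve the unknown `P`. -/
def gainMultiplier (u : Type*) [DecidableEq u] (X : Matrix z s ℝ) (γ : ℝ) :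
    Matrix ((s ⊕ u) ⊕ z) ((s ⊕ u) ⊕ z) ℝ :=
  Matrix.fromBlocks (Matrix.fromBlocks 0 0 0 (-γ • (1 : Matrix u u ℝ)))
    (Matrix.fromRows Xᵀ 0) (Matrix.fromCols X 0) (-γ • (1 : Matrix z z ℝ))

/-- Projection of `(x, u, w)` to the state `x`. -/
def stateMap (s u z : Type*) [DecidableEq s] : Matrix s ((s ⊕ u) ⊕ z) ℝ :=
  Matrix.fromCols (Matrix.fromCols 1 0) 0

/-- The map `(x, u, w) ↦ M x + B u`. -/
def derivMap (z : Type*) (M : Matrix s s ℝ) (B : Matrix s u ℝ) : Matrix s ((s ⊕ u) ⊕ z) ℝ :=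
  Matrix.fromCols (Matrix.fromCols M B) 0

/-- The matrix of the bounded real lemma. -/
def boundedRealBlock (M : Matrix s s ℝ) (B : Matrix s u ℝ) (X : Matrix z s ℝ)
    (P : Matrix s s ℝ) (γ : ℝ) : Matrix ((s ⊕ u) ⊕ z) ((s ⊕ u) ⊕ z) ℝ :=
  Matrix.fromBlocks
    (Matrix.fromBlocks (He M P) (P * B) (Bᵀ * P) (-γ • (1 : Matrix u u ℝ)))
    (Matrix.fromRows Xᵀ 0) (Matrix.fromCols X 0) (-γ • (1 : Matrix z z ℝ))

omit [Fintype z] [Fintype u] in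
theorem boundedRealBlock_eq (M : Matrix s s ℝ) (B : Matrix s u ℝ) (X : Matrix z s ℝ)
    {P : Matrix s s ℝ} (hP : Pᵀ = P) (γ : ℝ) :
    boundedRealBlock M B X P γ = (derivMap z M B)ᵀ * P * stateMap s u z +
      (stateMap s u z)ᵀ * P * derivMap z M B + gainMultiplier u X γ := by
  have h1 : (derivMap z M B)ᵀ * P * stateMap s u z = Matrix.fromBlocks
      (Matrix.fromBlocks (Mᵀ * P) 0 (Bᵀ * P) 0) 0 0 0 := by
    ext ((i | i) | i) ((j | j) | j) <;>
      simp [derivMap, stateMap, Matrix.mul_apply, Matrix.one_apply]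
  have h2 : (stateMap s u z)ᵀ * P * derivMap z M B = Matrix.fromBlocks
      (Matrix.fromBlocks (P * M) (P * B) 0 0) 0 0 0 := by
    ext ((i | i) | i) ((j | j) | j) <;>
      simp [derivMap, stateMap, Matrix.mul_apply, Matrix.one_apply]
  rw [h1, h2, boundedRealBlock, gainMultiplier, He, hP]
  simp [Matrix.fromBlocks_add]

omit [Fintype u] [Fintype z] [Fintype s] [DecidableEq s] in
theorem gainMultiplier_transpose (X : Matrix z s ℝ) (γ : ℝ) :
    (gainMultiplier u X γ)ᵀ = gainMultiplier u X γ := by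
  ext ((i | i) | i) ((j | j) | j) <;>
    simp [gainMultiplier, Matrix.one_apply, eq_comm]

omit [DecidableEq u] [DecidableEq z] in
theorem cplx_stateMap_mulVec (x : s → ℂ) (v : u → ℂ) (w : z → ℂ) :
    cplx (stateMap s u z) *ᵥ Sum.elim (Sum.elim x v) w = x := by
  ext i
  simp [stateMap, Matrix.mulVec, dotProduct, Matrix.one_apply, apply_ite, ite_mul]

omit [DecidableEq s] [DecidableEq u] [DecidableEq z] in
theorem cplx_derivMap_mulVec (M : Matrix s s ℝ) (B : Matrix s u ℝ) (x : s → ℂ) (v : u → ℂ)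
    (w : z → ℂ) :
    cplx (derivMap z M B) *ᵥ Sum.elim (Sum.elim x v) w = cplx M *ᵥ x + cplx B *ᵥ v := by
  ext i
  simp [derivMap, Matrix.mulVec, dotProduct]

omit [DecidableEq s] [DecidableEq u] [DecidableEq z] in
theorem norm_toLp_sq (x : s → ℂ) : ‖WithLp.toLp 2 x‖ ^ 2 = (star x ⬝ᵥ x).re := by
  rw [← inner_self_eq_norm_sq (𝕜 := ℂ), EuclideanSpace.inner_eq_star_dotProduct,
    dotProduct_comm]
  rfl

omit [DecidableEq s] in
/-- Value of the gain multiplier at `(x, v, w)`. -/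
theorem re_gainMultiplier (X : Matrix z s ℝ) (γ : ℝ) (x : s → ℂ) (v : u → ℂ) (w : z → ℂ) :
    (star (Sum.elim (Sum.elim x v) w) ⬝ᵥ
      (cplx (gainMultiplier u X γ) *ᵥ Sum.elim (Sum.elim x v) w)).re =
    -γ * ‖WithLp.toLp 2 v‖ ^ 2 + 2 * (star w ⬝ᵥ (cplx X *ᵥ x)).re
      - γ * ‖WithLp.toLp 2 w‖ ^ 2 := by
  have hmul : cplx (gainMultiplier u X γ) *ᵥ Sum.elim (Sum.elim x v) w =
      Sum.elim (Sum.elim ((cplx X)ᴴ *ᵥ w) ((-γ : ℂ) • v)) (cplx X *ᵥ x + (-γ : ℂ) • w) := by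
    ext ((i | i) | i) <;>
      simp [gainMultiplier, Matrix.mulVec, dotProduct, Matrix.one_apply, apply_ite, ite_mul]
  have hstar : star (Sum.elim (Sum.elim x v) w) =
      Sum.elim (Sum.elim (star x) (star v)) (star w) := by
    ext ((i | i) | i) <;> simp
  have hadj : (star x ⬝ᵥ ((cplx X)ᴴ *ᵥ w)).re = (star w ⬝ᵥ (cplx X *ᵥ x)).re := by
    rw [Matrix.dotProduct_mulVec, ← Matrix.star_mulVec, Matrix.star_dotProduct, Complex.star_def,
      Complex.conj_re]
  rw [hmul, hstar, sumElim_dotProduct_sumElim, sumElim_dotProduct_sumElim, dotProduct_smul,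
    dotProduct_add, dotProduct_smul, norm_toLp_sq, norm_toLp_sq]
  simp only [Complex.add_re, hadj, smul_eq_mul, ← Complex.ofReal_neg, Complex.re_ofReal_mul]
  ring

omit [DecidableEq z] in
theorem re_star_dotProduct_le (w y : z → ℂ) :
    (star w ⬝ᵥ y).re ≤ ‖WithLp.toLp 2 w‖ * ‖WithLp.toLp 2 y‖ := by
  have h := re_inner_le_norm (𝕜 := ℂ) (WithLp.toLp 2 w) (WithLp.toLp 2 y)
  rwa [EuclideanSpace.inner_eq_star_dotProduct, dotProduct_comm] at h

omit [DecidableEq u] [Fintype z] [DecidableEq z] in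
/-- Under the resolvent equation, the output is the transfer function applied to the input. -/
theorem transferFunction_mulVec {M : Matrix s s ℝ} (hM : IsHurwitz M) (B : Matrix s u ℝ)
    (X : Matrix z s ℝ) (w : ℝ) {x : s → ℂ} {v : u → ℂ}
    (h : cplx M *ᵥ x + cplx B *ᵥ v = (Complex.I * w) • x) :
    transferFunction M B X (Complex.I * w) *ᵥ v = cplx X *ᵥ x := by
  have hu := hM.isUnit_sub (l := Complex.I * w) (by simp)
  have h1 : cplx B *ᵥ v = ((Complex.I * w : ℂ) • 1 - cplx M) *ᵥ x := by
    rw [Matrix.sub_mulVec, Matrix.smul_mulVec, Matrix.one_mulVec, ← h, add_sub_cancel_left]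
  change (cplx X * ((Complex.I * w : ℂ) • 1 - cplx M)⁻¹ * cplx B) *ᵥ v = _
  rw [← Matrix.mulVec_mulVec, h1, Matrix.mulVec_mulVec, Matrix.mul_assoc,
    Matrix.nonsing_inv_mul _ ((Matrix.isUnit_iff_isUnit_det _).mp hu), Matrix.mul_one]

omit [DecidableEq u] in
theorem exists_state {M : Matrix s s ℝ} (hM : IsHurwitz M) (B : Matrix s u ℝ) (w : ℝ)
    (v : u → ℂ) : ∃ x : s → ℂ, cplx M *ᵥ x + cplx B *ᵥ v = (Complex.I * w) • x := by
  have hu := hM.isUnit_sub (l := Complex.I * w) (by simp)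
  refine ⟨((Complex.I * w : ℂ) • 1 - cplx M)⁻¹ *ᵥ (cplx B *ᵥ v), ?_⟩
  set x := ((Complex.I * w : ℂ) • 1 - cplx M)⁻¹ *ᵥ (cplx B *ᵥ v)
  have : ((Complex.I * w : ℂ) • 1 - cplx M) *ᵥ x = cplx B *ᵥ v := by
    rw [Matrix.mulVec_mulVec, Matrix.mul_nonsing_inv _ ((Matrix.isUnit_iff_isUnit_det _).mp hu),
      Matrix.one_mulVec]
  rw [← this, Matrix.sub_mulVec, Matrix.smul_mulVec, Matrix.one_mulVec, add_sub_cancel]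

open scoped Matrix.Norms.L2Operator in
/-- Sufficiency of the frequency domain condition in the **bounded real lemma**. -/
theorem IsHurwitz.exists_boundedReal {M : Matrix s s ℝ} (hM : IsHurwitz M) (B : Matrix s u ℝ)
    (X : Matrix z s ℝ) {γ : ℝ}
    (h : ∀ w : ℝ, ‖transferFunction M B X (Complex.I * w)‖ < γ) :
    ∃ P : Matrix s s ℝ, P.PosDef ∧ NegDef (boundedRealBlock M B X P γ) := by
  have hγ : 0 < γ := (norm_nonneg _).trans_lt (h 0)
  obtain ⟨P, hPt, hP⟩ := exists_negDef_of_frequency_domain (stateMap s u z) (derivMap z M B)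
    (gainMultiplier u X γ) (gainMultiplier_transpose X γ) (by
      intro f hf hfreq
      obtain ⟨x, v, w, rfl⟩ : ∃ x v w, f = Sum.elim (Sum.elim x v) w :=
        ⟨fun i => f (.inl (.inl i)), fun i => f (.inl (.inr i)), fun i => f (.inr i), by
          ext ((i | i) | i) <;> rfl⟩
      rw [cplx_stateMap_mulVec, cplx_derivMap_mulVec] at hfreq
      rw [re_gainMultiplier]
      -- The case x = 0 (infinite frequency) takes τ = 0; at a finite frequency τ is the norm of the
      -- transfer function. The form is then at most -γ‖v‖² + 2τ‖v‖‖w‖ - γ‖w‖², with τ < γ.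
      obtain ⟨τ, hτ0, hτ, hXx, hx⟩ : ∃ τ : ℝ, 0 ≤ τ ∧ τ < γ ∧
          ‖WithLp.toLp 2 (cplx X *ᵥ x)‖ ≤ τ * ‖WithLp.toLp 2 v‖ ∧ (v = 0 → x = 0) := by
        rcases hfreq with h0 | ⟨r, hr⟩
        · exact ⟨0, le_rfl, hγ, by simp [h0], fun _ => h0⟩
        · refine ⟨_, norm_nonneg _, h r, ?_, ?_⟩
          · rw [← transferFunction_mulVec hM B X r hr]
            exact Matrix.l2_opNorm_mulVec _ (WithLp.toLp 2 v)
          · rintro rfl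
            by_contra hx
            have := hM (Complex.I * r) (mem_eigenvalues_iff.mpr ⟨x, hx, by simpa using hr⟩)
            simp at this
      have h1 := re_star_dotProduct_le w (cplx X *ᵥ x)
      have h2 := mul_le_mul_of_nonneg_left hXx (norm_nonneg (WithLp.toLp 2 w))
      have hpos : 0 < ‖WithLp.toLp 2 v‖ ^ 2 + ‖WithLp.toLp 2 w‖ ^ 2 := by
        by_contra! hle
        have hv : v = 0 := by
          have : ‖WithLp.toLp 2 v‖ = 0 := by nlinarith [sq_nonneg ‖WithLp.toLp 2 w‖]
          simpa using this
        have hw : w = 0 := by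
          have : ‖WithLp.toLp 2 w‖ = 0 := by nlinarith [sq_nonneg ‖WithLp.toLp 2 v‖]
          simpa using this
        apply hf
        rw [hv, hw, hx hv]
        ext ((i | i) | i) <;> rfl
      nlinarith [mul_nonneg hτ0 (sq_nonneg (‖WithLp.toLp 2 v‖ - ‖WithLp.toLp 2 w‖)),
        mul_pos (sub_pos.mpr hτ) hpos])
  rw [← boundedRealBlock_eq M B X hPt] at hP
  refine ⟨P, hM.posDef_of_lyapunov hPt ?_, hP⟩
  have := Matrix.PosDef.submatrix hP (e := fun i : s => Sum.inl (Sum.inl i))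
    (Sum.inl_injective.comp Sum.inl_injective)
  rwa [show (-boundedRealBlock M B X P γ).submatrix _ _ = -He M P by
    ext i j; simp [boundedRealBlock]] at this

/-- Compactness of the unit sphere bounds (x ⬝ x) / (x ⬝ N x). The margin ε turns a strict
inequality into a gain bound uniform in frequency. -/
theorem exists_pos_posDef_sub_smul_one {N : Matrix s s ℝ} (hN : N.PosDef) :
    ∃ ε : ℝ, 0 < ε ∧ (N - ε • 1).PosDef := by
  obtain ⟨C, hC⟩ := (isCompact_sphere (0 : s → ℝ) 1).exists_bound_of_continuousOn
    (f := fun x : s → ℝ => (x ⬝ᵥ x) / (x ⬝ᵥ (N *ᵥ x))) (by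
      refine ContinuousOn.div (by fun_prop) (by fun_prop) fun x hx => ?_
      have hx0 : x ≠ 0 := by rintro rfl; simp at hx
      simpa using (hN.dotProduct_mulVec_pos hx0).ne')
  have hC1 : 0 < |C| + 1 := by positivity
  refine ⟨(|C| + 1)⁻¹, inv_pos.mpr hC1, ?_⟩
  refine Matrix.PosDef.of_dotProduct_mulVec_pos ?_ fun x hx => ?_
  · have := transpose_eq_of_posDef hN
    rw [Matrix.IsHermitian, Matrix.conjTranspose_eq_transpose_of_trivial]
    simp [this]
  · have hxn : 0 < ‖x‖ := norm_pos_iff.mpr hx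
    have h1 := hC (‖x‖⁻¹ • x) (by simp [norm_smul, hxn.ne'])
    have hNx : 0 < x ⬝ᵥ (N *ᵥ x) := by simpa using hN.dotProduct_mulVec_pos hx
    have h2 : ((‖x‖⁻¹ • x) ⬝ᵥ (‖x‖⁻¹ • x)) / ((‖x‖⁻¹ • x) ⬝ᵥ (N *ᵥ (‖x‖⁻¹ • x))) =
        (x ⬝ᵥ x) / (x ⬝ᵥ (N *ᵥ x)) := by
      simp only [Matrix.mulVec_smul, smul_dotProduct, dotProduct_smul, smul_eq_mul]
      field_simp
    rw [h2] at h1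
    have h3 : (x ⬝ᵥ x) / (x ⬝ᵥ (N *ᵥ x)) < |C| + 1 := by
      linarith [le_abs_self C, (le_abs_self _).trans h1]
    rw [div_lt_iff₀ hNx] at h3
    have h4 : (|C| + 1)⁻¹ * (x ⬝ᵥ x) < x ⬝ᵥ (N *ᵥ x) := by
      rw [inv_mul_lt_iff₀ hC1]
      exact h3
    simpa [Matrix.sub_mulVec, Matrix.smul_mulVec] using h4

omit [DecidableEq z] in
open scoped Matrix.Norms.L2Operator in
theorem l2_opNorm_le_of_sq_le (T : Matrix z u ℂ) {g : ℝ} (hg : 0 ≤ g)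
    (h : ∀ v : u → ℂ, ‖WithLp.toLp 2 (T *ᵥ v)‖ ^ 2 ≤ g ^ 2 * ‖WithLp.toLp 2 v‖ ^ 2) :
    ‖T‖ ≤ g := by
  rw [Matrix.l2_opNorm_def]
  refine ContinuousLinearMap.opNorm_le_bound _ hg fun v => ?_
  have := h v.ofLp
  rw [← mul_pow] at this
  exact le_of_sq_le_sq this (by positivity)

open scoped Matrix.Norms.L2Operator in
/-- Necessity of the frequency domain condition in the **bounded real lemma**. -/
theorem gain_lt_of_boundedReal [Nonempty z] {M : Matrix s s ℝ} {B : Matrix s u ℝ}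
    {X : Matrix z s ℝ} {P : Matrix s s ℝ} {γ : ℝ} (hP : P.PosDef)
    (h : NegDef (boundedRealBlock M B X P γ)) :
    IsHurwitz M ∧ ∃ g < γ, ∀ w : ℝ, ‖transferFunction M B X (Complex.I * w)‖ ≤ g := by
  have hPt := transpose_eq_of_posDef hP
  have hHe : NegDef (He M P) := by
    have := Matrix.PosDef.submatrix h (e := fun i : s => Sum.inl (Sum.inl i))
      (Sum.inl_injective.comp Sum.inl_injective)
    rwa [show (-boundedRealBlock M B X P γ).submatrix _ _ = -He M P by
      ext i j; simp [boundedRealBlock]] at this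
  have hM : IsHurwitz M := by
    intro l hl
    simpa using re_lt_of_lyapunov (r := 0) hP (by simpa using hHe) l hl
  obtain ⟨ε, hε, hε'⟩ := exists_pos_posDef_sub_smul_one h
  have hneg : NegDef (boundedRealBlock M B X P γ + ε • 1) := by
    rw [NegDef, neg_add']
    exact hε'
  -- Read off a diagonal entry of the output block, which exists because z is nonempty.
  have hg : 0 < γ - ε := by
    have := Matrix.PosDef.diag_pos hneg (i := .inr (Classical.arbitrary z))
    simp [boundedRealBlock] at this
    linarith
  refine ⟨hM, γ - ε, by linarith, fun w => l2_opNorm_le_of_sq_le _ hg.le fun v => ?_⟩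
  obtain ⟨x, hx⟩ := exists_state hM B w v
  rw [transferFunction_mulVec hM B X w hx]
  set y := cplx X *ᵥ x with hy
  -- The choice w = y / (γ - ε) maximizes 2 Re⟨w, y⟩ - (γ - ε)‖w‖², as in a Schur complement.
  obtain ⟨r, hr⟩ : ∃ r : ℝ, r * (γ - ε) = 1 := ⟨(γ - ε)⁻¹, inv_mul_cancel₀ hg.ne'⟩
  by_cases h0 : Sum.elim (Sum.elim x v) ((r : ℂ) • y) = 0
  · have hx0 : x = 0 := funext fun i => congrFun h0 (.inl (.inl i))
    have : y = 0 := by simp [y, hx0]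
    rw [this]
    simp
    positivity
  have h1 := hneg.re_lt h0
  have h2 := star_dotProduct_kyp (stateMap s u z) (derivMap z M B) P hPt
    (v := Sum.elim (Sum.elim x v) ((r : ℂ) • y)) (l := Complex.I * w) (by
      rw [cplx_stateMap_mulVec, cplx_derivMap_mulVec, hx])
  have h3 := re_gainMultiplier (u := u) X γ x v ((r : ℂ) • y)
  have h4 : (star (Sum.elim (Sum.elim x v) ((r : ℂ) • y)) ⬝ᵥ
      Sum.elim (Sum.elim x v) ((r : ℂ) • y)).re = ‖WithLp.toLp 2 x‖ ^ 2 +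
      ‖WithLp.toLp 2 v‖ ^ 2 + ‖WithLp.toLp 2 ((r : ℂ) • y)‖ ^ 2 := by
    rw [← norm_toLp_sq]
    simp [EuclideanSpace.norm_sq_eq]
  have h5 : ‖WithLp.toLp 2 ((r : ℂ) • y)‖ ^ 2 = r ^ 2 * ‖WithLp.toLp 2 y‖ ^ 2 := by
    rw [WithLp.toLp_smul, norm_smul, mul_pow, Complex.norm_real, Real.norm_eq_abs, sq_abs]
  have h6 : (star ((r : ℂ) • y) ⬝ᵥ (cplx X *ᵥ x)).re = r * ‖WithLp.toLp 2 y‖ ^ 2 := by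
    rw [← hy, norm_toLp_sq]
    simp
  have h7 : (Complex.I * w : ℂ).re = 0 := by simp
  rw [boundedRealBlock_eq M B X hPt, cplx_add, cplx_add, cplx_smul, cplx_one, Matrix.add_mulVec,
    Matrix.add_mulVec, Matrix.smul_mulVec, Matrix.one_mulVec, dotProduct_add, dotProduct_add,
    dotProduct_smul, Complex.add_re, Complex.add_re, h2, h3, smul_eq_mul, Complex.re_ofReal_mul,
    h4, h5, h6, h7] at h1
  have h8 : r * ‖WithLp.toLp 2 y‖ ^ 2 ≤ (γ - ε) * ‖WithLp.toLp 2 v‖ ^ 2 := by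
    have h9 : r ^ 2 * (γ - ε) = r := by rw [sq, mul_assoc, hr, mul_one]
    have h10 : 0 ≤ ε * ‖WithLp.toLp 2 x‖ ^ 2 := by positivity
    linear_combination h1.le + h10 + ‖WithLp.toLp 2 y‖ ^ 2 * h9
  calc ‖WithLp.toLp 2 y‖ ^ 2 = (γ - ε) * (r * ‖WithLp.toLp 2 y‖ ^ 2) := by
        rw [← mul_assoc, mul_comm (γ - ε), hr, one_mul]
    _ ≤ (γ - ε) * ((γ - ε) * ‖WithLp.toLp 2 v‖ ^ 2) := mul_le_mul_of_nonneg_left h8 hg.le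
    _ = (γ - ε) ^ 2 * ‖WithLp.toLp 2 v‖ ^ 2 := by ring

end BoundedReal

/-! ### Finiteness of the gain and the H∞ norm -/

section GainNorm

variable {s u z : Type*} [Fintype s] [DecidableEq s] [Fintype u] [DecidableEq u] [Fintype z]
  [DecidableEq z]

omit [DecidableEq z] in
open scoped Matrix.Norms.L2Operator in
/-- The frequency response of a stable system is bounded. -/
theorem IsHurwitz.exists_forall_norm_le {M : Matrix s s ℝ} (hM : IsHurwitz M) (B : Matrix s u ℝ)
    (X : Matrix z s ℝ) : ∃ g : ℝ, ∀ w : ℝ, ‖transferFunction M B X (Complex.I * w)‖ ≤ g := by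
  have : CompleteSpace (Matrix s s ℂ) := FiniteDimensional.complete ℂ _
  have hcont : Continuous fun w : ℝ => transferFunction M B X (Complex.I * w) := by
    have hd : ∀ w : ℝ, ((Complex.I * w : ℂ) • (1 : Matrix s s ℂ) - cplx M).det ≠ 0 := fun w =>
      ((Matrix.isUnit_iff_isUnit_det _).mp (hM.isUnit_sub (l := Complex.I * w) (by simp))).ne_zero
    have hA : Continuous fun w : ℝ => (Complex.I * w : ℂ) • (1 : Matrix s s ℂ) - cplx M := by
      fun_prop
    have hinv : Continuous fun w : ℝ => ((Complex.I * w : ℂ) • (1 : Matrix s s ℂ) - cplx M)⁻¹ := by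
      simp only [Matrix.inv_def, Ring.inverse_eq_inv']
      exact (hA.matrix_det.inv₀ hd).smul hA.matrix_adjugate
    exact (continuous_const.matrix_mul hinv).matrix_mul continuous_const
  -- The resolvent vanishes at infinity, so only a compact range of frequencies remains, where
  -- continuity gives a bound.
  have hlim : Filter.Tendsto (fun w : ℝ => ‖transferFunction M B X (Complex.I * w)‖)
      (Filter.cocompact ℝ) (nhds 0) := by
    have h1 : Filter.Tendsto (fun w : ℝ => Complex.I * (w : ℂ)) (Filter.cocompact ℝ)
        (Bornology.cobounded ℂ) := by
      rw [← tendsto_norm_atTop_iff_cobounded]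
      exact (tendsto_norm_cocompact_atTop (E := ℝ)).congr fun w => by simp
    have h2 := (spectrum.resolvent_tendsto_cobounded (𝕜 := ℂ) (cplx M)).comp h1
    have hc : Continuous fun R : Matrix s s ℂ => ‖cplx X * R * cplx B‖ := by fun_prop
    have h3 := (hc.tendsto 0).comp h2
    simp only [Matrix.mul_zero, Matrix.zero_mul, norm_zero] at h3
    refine h3.congr fun w => ?_
    simp only [Function.comp_apply, resolvent, Algebra.algebraMap_eq_smul_one,
      ← Matrix.nonsing_inv_eq_ringInverse]
    rfl
  obtain ⟨K, hK, hKs⟩ := Filter.mem_cocompact.mp (hlim.eventually_le_const zero_lt_one)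
  obtain ⟨C, hC⟩ := hK.exists_bound_of_continuousOn hcont.continuousOn
  refine ⟨max C 1, fun w => ?_⟩
  by_cases hw : w ∈ K
  · exact (hC w hw).trans (le_max_left _ _)
  · exact (hKs hw).trans (le_max_right _ _)

theorem IsHurwitz.hInfNorm_lt_top {M : Matrix s s ℝ} (hM : IsHurwitz M) (B : Matrix s u ℝ)
    (X : Matrix z s ℝ) : hInfNorm M B X < ⊤ := by
  obtain ⟨g, hg⟩ := hM.exists_forall_norm_le B X
  exact (iSup_le fun w => EReal.coe_le_coe_iff.mpr (hg w)).trans_lt (EReal.coe_lt_top g)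

-- The intermediate g is essential: a strict bound at each frequency would only give ≤ γ for the
-- supremum.
open scoped Matrix.Norms.L2Operator in
theorem hInfNorm_lt_iff (M : Matrix s s ℝ) (B : Matrix s u ℝ) (X : Matrix z s ℝ) (γ : ℝ) :
    hInfNorm M B X < γ ↔ ∃ g < γ, ∀ w : ℝ, ‖transferFunction M B X (Complex.I * w)‖ ≤ g := by
  constructor
  · intro h
    obtain ⟨g, hg1, hg2⟩ := EReal.lt_iff_exists_real_btwn.mp h
    exact ⟨g, EReal.coe_lt_coe_iff.mp hg2, fun w =>
      EReal.coe_le_coe_iff.mp ((le_iSup _ w).trans hg1.le)⟩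
  · rintro ⟨g, hg, h⟩
    exact (iSup_le fun w => EReal.coe_le_coe_iff.mpr (h w)).trans_lt (EReal.coe_lt_coe_iff.mpr hg)

/-- The **bounded real lemma**. -/
theorem exists_boundedReal_iff [Nonempty z] (M : Matrix s s ℝ) (B : Matrix s u ℝ)
    (X : Matrix z s ℝ) (γ : ℝ) :
    (∃ P : Matrix s s ℝ, P.PosDef ∧ NegDef (boundedRealBlock M B X P γ)) ↔
      IsHurwitz M ∧ hInfNorm M B X < γ := by
  rw [hInfNorm_lt_iff]
  refine ⟨fun ⟨P, hP, h⟩ => gain_lt_of_boundedReal hP h, fun ⟨hM, g, hg, h⟩ => ?_⟩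
  exact hM.exists_boundedReal B X fun w => (h w).trans_lt hg

end GainNorm

/-! ### From matrix inequalities to the optimization problems -/

section Design

variable {n p N : ℕ}

/-- Minimizing jointly over (K, γ) amounts to minimizing over γ first, for each K, and then over K.
-/
theorem optimalValue_eq_iInf {F : Gain n p N → ℝ → Prop} {R : Gain n p N → Prop}
    {h : Gain n p N → EReal} (hF : ∀ K, (∃ γ, F K γ) ↔ R K)
    (hval : ∀ K, R K → sInf {v : EReal | ∃ γ : ℝ, F K γ ∧ v = γ} = h K) :
    optimalValue F = ⨅ (K : Gain n p N) (_ : R K), h K := by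
  refine le_antisymm (le_iInf₂ fun K hK => ?_) (le_sInf ?_)
  · rw [← hval K hK]
    exact sInf_le_sInf fun v ⟨γ, hγ, hv⟩ => ⟨K, γ, hγ, hv⟩
  · rintro v ⟨K, γ, hγ, hv⟩
    have hK := (hF K).mp ⟨γ, hγ⟩
    refine (iInf₂_le K hK).trans ?_
    rw [← hval K hK]
    exact sInf_le ⟨γ, hγ, hv⟩

variable (A : Matrix (Fin n) (Fin n) ℝ) (C : Matrix (Fin p) (Fin n) ℝ)
  (Γ : Digraph (Fin N)) {z : Type*} [Fintype z] [DecidableEq z]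

theorem minimizesGain_iff_solves {F : Gain n p N → ℝ → Prop} {R : Gain n p N → Prop}
    {X : Matrix z (Fin N × Fin n) ℝ} (hF : ∀ K, (∃ γ, F K γ) ↔ R K)
    (hval : ∀ K, R K → sInf {v : EReal | ∃ γ : ℝ, F K γ ∧ v = γ} = hInfGain A C Γ X K)
    (K : Gain n p N) : MinimizesGain A C Γ R X K ↔ Solves F K := by
  rw [MinimizesGain, Solves, hF, optimalValue_eq_iInf hF hval]
  refine and_congr_right fun hK => ?_
  rw [hval K hK]
  constructor
  · intro h
    exact le_antisymm (le_iInf₂ h) (iInf₂_le K hK)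
  · intro h K' hK'
    rw [h]
    exact iInf₂_le K' hK'

/-- Reals strictly above a already approach it, so strict and non-strict constraints on γ have the
same infimum. -/
theorem sInf_coe_gt {a : EReal} {Q : ℝ → Prop} (h : ∀ γ : ℝ, a < γ → Q γ)
    (h' : ∀ γ : ℝ, Q γ → a ≤ γ) : sInf {v : EReal | ∃ γ : ℝ, Q γ ∧ v = γ} = a := by
  refine le_antisymm (le_of_forall_gt fun b hb => ?_) (le_sInf ?_)
  · obtain ⟨g, hg1, hg2⟩ := EReal.lt_iff_exists_real_btwn.mp hb
    exact lt_of_le_of_lt (sInf_le ⟨g, h g hg1, rfl⟩) hg2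
  · rintro v ⟨γ, hγ, rfl⟩
    exact h' γ hγ

variable {A C Γ}

theorem feasible_iff [Nonempty z] [NeZero n] [NeZero N] (X : Matrix z (Fin N × Fin n) ℝ) (σ : ℝ)
    (K : Gain n p N) (γ : ℝ) :
    Feasible A C Γ X σ K γ ↔ RateGT A C Γ σ K ∧ hInfGain A C Γ X K < γ := by
  have h1 := exists_lyapunov_iff (calA A C Γ K) σ
  have h2 := exists_boundedReal_iff (calA A C Γ K) (calB Γ K) X γ
  constructor
  · rintro ⟨P_S, P_H, hS, hH, hPS, hPH⟩
    obtain ⟨hM, hγ⟩ := h2.mp ⟨P_H, hPH, hH⟩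
    exact ⟨⟨hM, (hM.lt_convergenceRate_iff σ).mpr (h1.mp ⟨P_S, hPS, hS⟩)⟩, hγ⟩
  · rintro ⟨⟨hM, hσ⟩, hγ⟩
    obtain ⟨P_S, hPS, hS⟩ := h1.mpr ((hM.lt_convergenceRate_iff σ).mp hσ)
    obtain ⟨P_H, hPH, hH⟩ := h2.mpr ⟨hM, hγ⟩
    exact ⟨P_S, P_H, hS, hH, hPS, hPH⟩

/-- Hurwitz stability survives the limit because each relaxed problem already forces it; only the
rate and gain bounds become non-strict. -/
theorem limitFeasible_iff [Nonempty z] [NeZero n] [NeZero N] (X : Matrix z (Fin N × Fin n) ℝ)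
    (σ : ℝ) (K : Gain n p N) (γ : ℝ) :
    LimitFeasible A C Γ X σ K γ ↔ RateGE A C Γ σ K ∧ hInfGain A C Γ X K ≤ γ := by
  simp only [LimitFeasible, feasible_iff]
  constructor
  · intro h
    refine ⟨⟨(h (σ - 1) (by linarith) (γ + 1) (by linarith)).1.1, le_of_forall_lt fun σ' hσ' =>
      (h σ' hσ' (γ + 1) (by linarith)).1.2⟩, le_of_forall_gt fun b hb => ?_⟩
    obtain ⟨g, hg1, hg2⟩ := EReal.lt_iff_exists_real_btwn.mp hb
    exact (h (σ - 1) (by linarith) g (EReal.coe_lt_coe_iff.mp hg1)).2.trans hg2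
  · rintro ⟨⟨hM, hσ⟩, hγ⟩ σ' hσ' γ' hγ'
    exact ⟨⟨hM, hσ'.trans_le hσ⟩, hγ.trans_lt (EReal.coe_lt_coe_iff.mpr hγ')⟩

/-- Equivalence of gain minimization and the matrix inequality problem, for a fixed output. -/
theorem design_equivalence [Nonempty z] [NeZero n] [NeZero N] (A : Matrix (Fin n) (Fin n) ℝ)
    (C : Matrix (Fin p) (Fin n) ℝ) (Γ : Digraph (Fin N)) (X : Matrix z (Fin N × Fin n) ℝ) (σ : ℝ) :
    (∀ (K : Gain n p N) (γ : ℝ), Feasible A C Γ X σ K γ ↔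
        RateGT A C Γ σ K ∧ hInfGain A C Γ X K < γ) ∧
      optimalValue (Feasible A C Γ X σ) =
        (⨅ (K : Gain n p N) (_ : RateGT A C Γ σ K), hInfGain A C Γ X K) ∧
      (∀ K : Gain n p N, MinimizesGain A C Γ (RateGT A C Γ σ) X K ↔
        Solves (Feasible A C Γ X σ) K) ∧
      (∀ (K : Gain n p N) (γ : ℝ), LimitFeasible A C Γ X σ K γ ↔
        RateGE A C Γ σ K ∧ hInfGain A C Γ X K ≤ γ) ∧
      optimalValue (LimitFeasible A C Γ X σ) =
        (⨅ (K : Gain n p N) (_ : RateGE A C Γ σ K), hInfGain A C Γ X K) ∧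
      (∀ K : Gain n p N, MinimizesGain A C Γ (RateGE A C Γ σ) X K ↔
        Solves (LimitFeasible A C Γ X σ) K) := by
  -- Stable systems have finite gain, so every gain meeting the rate specification is admissible for
  -- some real γ.
  have hreal : ∀ K : Gain n p N, IsHurwitz (calA A C Γ K) →
      ∃ γ : ℝ, hInfGain A C Γ X K < γ := fun K hK => by
    obtain ⟨γ, hγ, -⟩ := EReal.lt_iff_exists_real_btwn.mp (hK.hInfNorm_lt_top (calB Γ K) X)
    exact ⟨γ, hγ⟩
  have hF : ∀ K, (∃ γ, Feasible A C Γ X σ K γ) ↔ RateGT A C Γ σ K := fun K => by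
    simp only [feasible_iff]
    exact ⟨fun ⟨_, h, _⟩ => h, fun h => (hreal K h.1).imp fun γ hγ => ⟨h, hγ⟩⟩
  have hL : ∀ K, (∃ γ, LimitFeasible A C Γ X σ K γ) ↔ RateGE A C Γ σ K := fun K => by
    simp only [limitFeasible_iff]
    exact ⟨fun ⟨_, h, _⟩ => h, fun h => (hreal K h.1).imp fun γ hγ => ⟨h, hγ.le⟩⟩
  have hFval : ∀ K, RateGT A C Γ σ K →
      sInf {v : EReal | ∃ γ : ℝ, Feasible A C Γ X σ K γ ∧ v = γ} = hInfGain A C Γ X K :=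
    fun K hK => sInf_coe_gt (fun γ hγ => (feasible_iff X σ K γ).mpr ⟨hK, hγ⟩)
      fun γ hγ => ((feasible_iff X σ K γ).mp hγ).2.le
  have hLval : ∀ K, RateGE A C Γ σ K →
      sInf {v : EReal | ∃ γ : ℝ, LimitFeasible A C Γ X σ K γ ∧ v = γ} = hInfGain A C Γ X K :=
    fun K hK => sInf_coe_gt (fun γ hγ => (limitFeasible_iff X σ K γ).mpr ⟨hK, hγ.le⟩)
      fun γ hγ => ((limitFeasible_iff X σ K γ).mp hγ).2
  exact ⟨feasible_iff X σ, optimalValue_eq_iInf hF hFval, minimizesGain_iff_solves A C Γ hF hFval,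
    limitFeasible_iff X σ, optimalValue_eq_iInf hL hLval, minimizesGain_iff_solves A C Γ hL hLval⟩

end Design

end InterconnectedObserver

open InterconnectedObserver in
theorem mainTheorem4 {n p N : ℕ} (hn : 0 < n) (hN : 0 < N)
    (A : Matrix (Fin n) (Fin n) ℝ) (C : Matrix (Fin p) (Fin n) ℝ)
    (Γ : Digraph (Fin N)) (hΓ : ∀ i, Γ.Adj i i) (σ : ℝ) :
    -- global gain
    ((∀ (K : Gain n p N) (γ : ℝ), Feasible A C Γ (calC n Γ) σ K γ ↔
          RateGT A C Γ σ K ∧ hInfGain A C Γ (calC n Γ) K < γ) ∧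
      optimalValue (Feasible A C Γ (calC n Γ) σ) =
          (⨅ (K : Gain n p N) (_ : RateGT A C Γ σ K), hInfGain A C Γ (calC n Γ) K) ∧
      (∀ K : Gain n p N, MinimizesGain A C Γ (RateGT A C Γ σ) (calC n Γ) K ↔
          Solves (Feasible A C Γ (calC n Γ) σ) K) ∧
      (∀ (K : Gain n p N) (γ : ℝ), LimitFeasible A C Γ (calC n Γ) σ K γ ↔
          RateGE A C Γ σ K ∧ hInfGain A C Γ (calC n Γ) K ≤ γ) ∧
      optimalValue (LimitFeasible A C Γ (calC n Γ) σ) =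
          (⨅ (K : Gain n p N) (_ : RateGE A C Γ σ K), hInfGain A C Γ (calC n Γ) K) ∧
      (∀ K : Gain n p N, MinimizesGain A C Γ (RateGE A C Γ σ) (calC n Γ) K ↔
          Solves (LimitFeasible A C Γ (calC n Γ) σ) K)) ∧
    -- local gain at agent `i`
    (∀ i : Fin N,
      (∀ (K : Gain n p N) (γ : ℝ), Feasible A C Γ (calCLocal n Γ i) σ K γ ↔
          RateGT A C Γ σ K ∧ hInfGain A C Γ (calCLocal n Γ i) K < γ) ∧
      optimalValue (Feasible A C Γ (calCLocal n Γ i) σ) =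
          (⨅ (K : Gain n p N) (_ : RateGT A C Γ σ K), hInfGain A C Γ (calCLocal n Γ i) K) ∧
      (∀ K : Gain n p N, MinimizesGain A C Γ (RateGT A C Γ σ) (calCLocal n Γ i) K ↔
          Solves (Feasible A C Γ (calCLocal n Γ i) σ) K) ∧
      (∀ (K : Gain n p N) (γ : ℝ), LimitFeasible A C Γ (calCLocal n Γ i) σ K γ ↔
          RateGE A C Γ σ K ∧ hInfGain A C Γ (calCLocal n Γ i) K ≤ γ) ∧
      optimalValue (LimitFeasible A C Γ (calCLocal n Γ i) σ) =
          (⨅ (K : Gain n p N) (_ : RateGE A C Γ σ K), hInfGain A C Γ (calCLocal n Γ i) K) ∧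
      (∀ K : Gain n p N, MinimizesGain A C Γ (RateGE A C Γ σ) (calCLocal n Γ i) K ↔
          Solves (LimitFeasible A C Γ (calCLocal n Γ i) σ) K)) := by
  -- Positivity of n and N makes the state and output index types nonempty.
  have : NeZero n := ⟨hn.ne'⟩
  have : NeZero N := ⟨hN.ne'⟩
  exact ⟨design_equivalence A C Γ (calC n Γ) σ, fun i =>
    design_equivalence A C Γ (calCLocal n Γ i) σ⟩
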